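/- Let $p\ge 1$ be fixed and let $y=X\beta^*+\varepsilon$ with $\beta^*\in\mathbb R^p$, deterministic designs $X=X_n\in\mathbb R^{n\times p}$ with rows $x_i$, and $\varepsilon_1,\dots,\varepsilon_n$ i.i.d. $\mathcal N(0,\sigma^2)$, $\sigma>0$. Assume that, as $n\to\infty$, $\frac1n X^\top X\to C$ with $C$ positive definite and $\frac1n\max_i\|x_i\|_2^2\to 0$. Let $m=m_n$ be positive integers (for all large $n$) with $n/m\to r_0\ge 0$, and let $\tilde\beta=\tilde\beta_n$ be an initial estimator, independent of $\varepsilon$, such that $\sqrt m(\tilde\beta-\beta^*)$ converges in distribution to some probability law $\nu$ on $\mathbb R^p$. For $\lambda_n,\eta_n\ge 0$ let $\hat\beta_n$ be a Transfer Lasso estimator, that is, a (measurable) minimiser over $\beta\in\mathbb R^p$ of $$\frac1n\|y-X\beta\|_2^2+\frac{\lambda_n}{n}\sum_j|\beta_j|+\frac{\eta_n}{n}\sum_j|\beta_j-\tilde\beta_j|.$$ Say that the convergence rate of $\hat\beta_n$ is at least $a_n$ if $a_n(\hat\beta_n-\beta^*)$ converges in distribution to some probability law; that it is (exactly) $a_n$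 if moreover this law is not the point mass $\delta_0$ at $0$; and that it is faster than $a_n$ if $a_n(\hat\beta_n-\beta^*)\to 0$ in probability. Then: (i) If $\eta_n/\sqrt n\to\infty$ and $\lambda_n/\eta_n\to\rho_0$ with $0\le\rho_0<1$, then the convergence rate is at least $\sqrt m$, and it is exactly $\sqrt m$ if $\nu\ne\delta_0$. (ii) If $\lambda_n/\sqrt n\to\lambda_0\ge0$ and $\eta_n/\sqrt n\to\eta_0\ge0$, then the convergence rate is exactly $\sqrt n$. (iii) Let $\lambda_n/\sqrt n\to\infty$, $\lambda_n/n\to0$ and $\eta_n/\lambda_n\to\rho_0'\ge 0$. If $\rho_0'<1$, then the convergence rate is at least $n/\lambda_n$, where $n/\lambda_n=o(\sqrt n)$; if moreover $\beta^*\neq0$, then it is exactly $n/\lambda_n$, and it is slower than $\sqrt n$ in the sense that $\sqrt n(\hat\beta_n-\beta^*)$ is not bounded in probability. If $\rho_0'\ge1$, then the convergence rate is faster than $n/\lambda_n$. -/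

import Mathlib

open Filter Topology MeasureTheory ProbabilityTheory
open scoped Matrix NNReal

noncomputable section

/-- The Transfer Lasso objective
`(1/n) ‖y - X β‖₂² + (lam/n) ∑ⱼ |βⱼ| + (eta/n) ∑ⱼ |βⱼ - β₀ⱼ|`,
with source (initial) parameter `β₀`. -/
def transferLassoObjective {n p : ℕ} (X : Matrix (Fin n) (Fin p) ℝ) (y : Fin n → ℝ)
    (lam eta : ℝ) (β₀ β : EuclideanSpace ℝ (Fin p)) : ℝ :=
  (1 / (n : ℝ)) * ∑ i, (y i - (X *ᵥ β.ofLp) i) ^ 2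
    + (lam / n) * ∑ j, |β j| + (eta / n) * ∑ j, |β j - β₀ j|

/-- `β` is a Transfer Lasso estimate: a global minimiser of the objective. -/
def IsTransferLasso {n p : ℕ} (X : Matrix (Fin n) (Fin p) ℝ) (y : Fin n → ℝ)
    (lam eta : ℝ) (β₀ β : EuclideanSpace ℝ (Fin p)) : Prop :=
  IsMinOn (transferLassoObjective X y lam eta β₀) Set.univ β

/-- The design condition: the Gram matrices `(1/n) XᵀX` converge to a positive definite
matrix, and `(1/n) maxᵢ ‖xᵢ‖₂² → 0`, where `xᵢ` are the rows of the `n × p` design `X n`. -/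
def DesignCondition {p : ℕ} (X : (n : ℕ) → Matrix (Fin n) (Fin p) ℝ) : Prop :=
  (∃ C : Matrix (Fin p) (Fin p) ℝ, C.PosDef ∧
    Tendsto (fun n : ℕ => (1 / (n : ℝ)) • ((X n)ᵀ * X n)) atTop (𝓝 C)) ∧
  Tendsto (fun n : ℕ => (1 / (n : ℝ)) * ⨆ i : Fin n, ∑ j, (X n i j) ^ 2) atTop (𝓝 0)

section Rates

variable {Ω E : Type*} [MeasurableSpace Ω] [NormedAddCommGroup E] [NormedSpace ℝ E]
  [MeasurableSpace E] [BorelSpace E]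

/-- `a n • err n` converges in distribution to some probability law (possibly the point
mass at `0`): the estimation error is of order at most `1 / a n`. -/
def ConvergesAtRate (P : Measure Ω) [IsProbabilityMeasure P] (err : ℕ → Ω → E)
    (a : ℕ → ℝ) : Prop :=
  ∃ L : ProbabilityMeasure E,
    TendstoInDistribution (fun n ω => a n • err n ω) atTop id (fun _ => P) (L : Measure E)

/-- The convergence rate is (exactly) `a n`: `a n • err n` converges in distribution to a
probability law which is not the point mass at `0`. -/
def HasConvergenceRate (P : Measure Ω) [IsProbabilityMeasure P] (err : ℕ → Ω → E)
    (a : ℕ → ℝ) : Prop :=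
  ∃ L : ProbabilityMeasure E,
    TendstoInDistribution (fun n ω => a n • err n ω) atTop id (fun _ => P) (L : Measure E) ∧
    (L : Measure E) ≠ Measure.dirac 0

/-- The convergence rate is faster than `a n`: `a n • err n → 0` in probability. -/
def HasRateFasterThan (P : Measure Ω) (err : ℕ → Ω → E) (a : ℕ → ℝ) : Prop :=
  TendstoInMeasure P (fun n ω => a n • err n ω) atTop (fun _ => 0)

/-- `Y n = O_P(1)`. -/
def IsBoundedInProbability (P : Measure Ω) (Y : ℕ → Ω → E) : Prop :=
  ∀ δ : ℝ, 0 < δ → ∃ K : ℝ, ∀ᶠ n in atTop, P.real {ω | K < ‖Y n ω‖} ≤ δ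

end Rates

end

/-!
In the local parameter `u = β - β*`, and up to a constant, the Transfer Lasso objective is a
quadratic form `⟪A u, u⟫ - 2 ⟪w, u⟫` plus the convex penalty
`a (‖β* + u‖₁ - ‖β*‖₁) + b ‖u - δ‖₁`, where `A` is the normalised Gram matrix, `w` the score and
`δ = β̃ - β*`. Rescaling `u` by `s → ∞` turns the first part of the penalty into an approximation of
the directional derivative of the `ℓ¹` norm at `β*`, uniformly on bounded sets. Since `A` is
eventually coercive, the rescaled minimiser is bounded in terms of the data and stays close to the
minimiser of the limit problem, which depends continuously on the data; the continuous mapping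
theorem then gives the limit law.

* At scale `√n` all terms are of the same order. If the limit minimiser vanished almost surely,
  then the first-order condition would bound the limiting score, which is Gaussian.
* At scale `n / λ` the data disappear and the limit problem is deterministic: minimise
  `⟪C u, u⟫ + D u + ρ ‖u‖₁`, where `D` is the directional derivative of the `ℓ¹` norm at `β*`. If
  `ρ < 1` and `β* ≠ 0`, moving towards `-β*` lowers it below its value at `0`, and if `1 ≤ ρ` its
  minimiser is `0`.
* If `η` dominates both `√n` and `λ`, then on an event where the rescaled data are bounded the kink
  of the transfer penalty at `δ` outweighs all other slopes, so that `β̂ = β̃` for all large `n`.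
-/

noncomputable section

open scoped RealInnerProductSpace

section PenalizedQuadratic

variable {E : Type*} [NormedAddCommGroup E] [InnerProductSpace ℝ E]

/-- The quadratic function `u ↦ ⟪A u, u⟫ - 2 ⟪w, u⟫` plus a penalty `h`: the shape of a penalised
least squares objective in a local parameter `u`. -/
def penalizedQuadratic (A : E →L[ℝ] E) (w : E) (h : E → ℝ) (u : E) : ℝ :=
  ⟪A u, u⟫ - 2 * ⟪w, u⟫ + h u

/-- A quadratic form and a penalty for which, if `0 < c`, the minimiser of
`penalizedQuadratic A w h` exists, is unique and is stable: the form is coercive with constant `c`,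
and the penalty is convex and Lipschitz with constant `L`. -/
structure IsWellPosed (c L : ℝ) (A : E →L[ℝ] E) (h : E → ℝ) : Prop where
  coercive : ∀ v, c * ‖v‖ ^ 2 ≤ ⟪A v, v⟫
  convexOn : ConvexOn ℝ Set.univ h
  abs_sub_le : ∀ u v, |h u - h v| ≤ L * ‖u - v‖

variable {A A' : E →L[ℝ] E} {c L : ℝ} {w w' u u' : E} {h h' : E → ℝ}

lemma abs_inner_apply_le (A : E →L[ℝ] E) (u v : E) : |⟪A u, v⟫| ≤ ‖A‖ * ‖u‖ * ‖v‖ :=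
  (abs_real_inner_le_norm _ _).trans (by gcongr; exact A.le_opNorm u)

lemma penalizedQuadratic_lineMap_le (hh : ConvexOn ℝ Set.univ h) (u v : E) {t : ℝ} (ht₀ : 0 ≤ t)
    (ht₁ : t ≤ 1) :
    penalizedQuadratic A w h (AffineMap.lineMap u v t) ≤
      (1 - t) * penalizedQuadratic A w h u + t * penalizedQuadratic A w h v
        - t * (1 - t) * ⟪A (v - u), v - u⟫ := by
  have hconvex := hh.2 (Set.mem_univ u) (Set.mem_univ v) (sub_nonneg.2 ht₁) ht₀ (by ring)
  simp only [smul_eq_mul] at hconvex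
  simp only [AffineMap.lineMap_apply_module, penalizedQuadratic, map_add, map_sub, map_smul,
    inner_add_left, inner_add_right, inner_sub_left, inner_sub_right, real_inner_smul_left,
    real_inner_smul_right]
  linear_combination hconvex

lemma mul_sq_norm_sub_le_of_isMinOn (hA : ∀ v, c * ‖v‖ ^ 2 ≤ ⟪A v, v⟫)
    (hh : ConvexOn ℝ Set.univ h) (hu : IsMinOn (penalizedQuadratic A w h) Set.univ u) (v : E) :
    c * ‖v - u‖ ^ 2 ≤ penalizedQuadratic A w h v - penalizedQuadratic A w h u := by
  refine (hA _).trans ?_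
  have hsegment : ∀ t ∈ Set.Ioo (0 : ℝ) 1, (1 - t) * ⟪A (v - u), v - u⟫ ≤
      penalizedQuadratic A w h v - penalizedQuadratic A w h u := by
    rintro t ⟨ht₀, ht₁⟩
    have hle := (hu (Set.mem_univ _)).trans
      (penalizedQuadratic_lineMap_le (A := A) (w := w) hh u v ht₀.le ht₁.le)
    refine le_of_mul_le_mul_left ?_ ht₀
    linear_combination hle
  have hlim : Tendsto (fun t : ℝ => (1 - t) * ⟪A (v - u), v - u⟫) (𝓝[>] 0)
      (𝓝 ((1 - 0) * ⟪A (v - u), v - u⟫)) :=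
    ((continuous_const.sub continuous_id).mul continuous_const).continuousWithinAt
  rw [sub_zero, one_mul] at hlim
  exact le_of_tendsto hlim (mem_of_superset (Ioo_mem_nhdsGT zero_lt_one) hsegment)

lemma mul_norm_sq_sub_le_penalizedQuadratic_sub (hA : ∀ v, c * ‖v‖ ^ 2 ≤ ⟪A v, v⟫)
    (hh : ∀ u, h 0 - L * ‖u‖ ≤ h u) (w u : E) :
    c * ‖u‖ ^ 2 - (2 * ‖w‖ + L) * ‖u‖ ≤
      penalizedQuadratic A w h u - penalizedQuadratic A w h 0 := by
  simp only [penalizedQuadratic, map_zero, inner_zero_right]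
  linear_combination hA u + 2 * real_inner_le_norm w u + hh u

lemma norm_le_of_penalizedQuadratic_le (hc : 0 < c) (hL : 0 ≤ L)
    (hA : ∀ v, c * ‖v‖ ^ 2 ≤ ⟪A v, v⟫) (hh : ∀ u, h 0 - L * ‖u‖ ≤ h u)
    (hu : penalizedQuadratic A w h u ≤ penalizedQuadratic A w h 0) :
    ‖u‖ ≤ (2 * ‖w‖ + L) / c := by
  rcases (norm_nonneg u).eq_or_lt with hzero | hpos
  · rw [← hzero]; positivity
  · rw [le_div_iff₀ hc]
    refine le_of_mul_le_mul_right ?_ hpos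
    linear_combination mul_norm_sq_sub_le_penalizedQuadratic_sub hA hh w u + hu

lemma mul_sq_norm_sub_le_of_isMinOn_of_isMinOn (hA : ∀ v, c * ‖v‖ ^ 2 ≤ ⟪A v, v⟫)
    (hh : ConvexOn ℝ Set.univ h) (hu : IsMinOn (penalizedQuadratic A w h) Set.univ u)
    (hu' : IsMinOn (penalizedQuadratic A' w' h') Set.univ u') {R : ℝ} (huR : ‖u‖ ≤ R)
    (huR' : ‖u'‖ ≤ R) :
    c * ‖u' - u‖ ^ 2 ≤ 2 * ‖A - A'‖ * R ^ 2 + 4 * ‖w - w'‖ * R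
      + |h u' - h' u'| + |h u - h' u| := by
  have hgrowth := mul_sq_norm_sub_le_of_isMinOn hA hh hu u'
  have hle : penalizedQuadratic A' w' h' u' ≤ penalizedQuadratic A' w' h' u :=
    hu' (Set.mem_univ u)
  have hR : 0 ≤ R := (norm_nonneg u).trans huR
  have hquad : ∀ v, ‖v‖ ≤ R → |⟪(A - A') v, v⟫| ≤ ‖A - A'‖ * R * R := fun v hv =>
    (abs_inner_apply_le _ v v).trans (by gcongr)
  have hlin : ∀ v, ‖v‖ ≤ R → |⟪w - w', v⟫| ≤ ‖w - w'‖ * R := fun v hv =>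
    (abs_real_inner_le_norm _ v).trans (by gcongr)
  have hquad₁ := (abs_le.1 (hquad u huR)).1
  have hquad₂ := (abs_le.1 (hquad u' huR')).2
  have hlin₁ := (abs_le.1 (hlin u huR)).2
  have hlin₂ := (abs_le.1 (hlin u' huR')).1
  simp only [sub_apply, inner_sub_left] at hquad₁ hquad₂ hlin₁ hlin₂
  simp only [penalizedQuadratic] at hgrowth hle
  linear_combination hgrowth + hle + hquad₁ + hquad₂ + 2 * hlin₁ + 2 * hlin₂ +
    le_abs_self (h u' - h' u') + neg_le_abs (h u - h' u)

lemma two_mul_inner_le_of_isMinOn_zero (hmin : IsMinOn (penalizedQuadratic A w h) Set.univ 0)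
    {v : E} {ℓ : ℝ} (hh : ∀ t : ℝ, 0 < t → h (t • v) ≤ h 0 + t * ℓ) : 2 * ⟪w, v⟫ ≤ ℓ := by
  have hray : ∀ t : ℝ, 0 < t → 2 * ⟪w, v⟫ ≤ ℓ + t * ⟪A v, v⟫ := by
    intro t ht
    have hle : penalizedQuadratic A w h 0 ≤ penalizedQuadratic A w h (t • v) :=
      hmin (Set.mem_univ _)
    simp only [penalizedQuadratic, map_zero, map_smul, inner_zero_right, real_inner_smul_left,
      real_inner_smul_right] at hle
    refine le_of_mul_le_mul_left ?_ ht
    linear_combination hle + hh t ht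
  have hlim : Tendsto (fun t : ℝ => ℓ + t * ⟪A v, v⟫) (𝓝[>] 0) (𝓝 (ℓ + 0 * ⟪A v, v⟫)) :=
    (continuous_const.add (continuous_id.mul continuous_const)).continuousWithinAt
  rw [zero_mul, add_zero] at hlim
  exact ge_of_tendsto hlim (eventually_mem_nhdsWithin.mono hray)

lemma eq_of_penalizedQuadratic_le_of_sharp (hA : ∀ v, 0 ≤ ⟪A v, v⟫) {d : E} {κ : ℝ}
    (hh : ∀ v, h d + κ * ‖v - d‖ ≤ h v) (hκ : 2 * ‖w‖ + 2 * ‖A‖ * ‖d‖ < κ)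
    (hu : penalizedQuadratic A w h u ≤ penalizedQuadratic A w h d) : u = d := by
  have hcross₁ := (abs_le.1 (abs_inner_apply_le A d (u - d))).1
  have hcross₂ := (abs_le.1 (abs_inner_apply_le A (u - d) d)).1
  have hlin := real_inner_le_norm w (u - d)
  have hquad := hA (u - d)
  have hgap : (κ - (2 * ‖w‖ + 2 * ‖A‖ * ‖d‖)) * ‖u - d‖ ≤ 0 := by
    simp only [penalizedQuadratic] at hu
    simp only [map_sub, inner_sub_left, inner_sub_right] at hcross₁ hcross₂ hlin hquad
    linear_combination hh u + hu + hquad + hcross₁ + hcross₂ + 2 * hlin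
  exact sub_eq_zero.1 (norm_le_zero_iff.1 (nonpos_of_mul_nonpos_right hgap (sub_pos.2 hκ)))

namespace IsWellPosed

lemma continuous (hwp : IsWellPosed c L A h) : Continuous h :=
  (LipschitzWith.of_dist_le' fun u v => by
    simpa [Real.dist_eq, dist_eq_norm] using hwp.abs_sub_le u v).continuous

lemma sub_le (hwp : IsWellPosed c L A h) (u : E) : h 0 - L * ‖u‖ ≤ h u := by
  have hle := (abs_le.1 (hwp.abs_sub_le u 0)).1
  rw [sub_zero] at hle
  linear_combination hle

lemma norm_le_of_isMinOn (hwp : IsWellPosed c L A h) (hc : 0 < c) (hL : 0 ≤ L)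
    (hu : IsMinOn (penalizedQuadratic A w h) Set.univ u) : ‖u‖ ≤ (2 * ‖w‖ + L) / c :=
  norm_le_of_penalizedQuadratic_le hc hL hwp.coercive hwp.sub_le (hu (Set.mem_univ 0))

lemma exists_isMinOn [ProperSpace E] (hwp : IsWellPosed c L A h) (hc : 0 < c) (w : E) :
    ∃ u, IsMinOn (penalizedQuadratic A w h) Set.univ u := by
  have hcont : Continuous (penalizedQuadratic A w h) := by
    have := hwp.continuous
    unfold penalizedQuadratic
    fun_prop
  have hgrowth : Tendsto (fun x : ℝ => x * (c * x - (2 * ‖w‖ + L)) + penalizedQuadratic A w h 0)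
      atTop atTop :=
    tendsto_atTop_add_const_right _ _ (tendsto_id.atTop_mul_atTop₀
      (tendsto_atTop_add_const_right _ _ (tendsto_id.const_mul_atTop hc)))
  have hcoercive : Tendsto (penalizedQuadratic A w h) (cocompact E) atTop := by
    refine tendsto_atTop_mono (fun u => ?_) (hgrowth.comp tendsto_norm_cocompact_atTop)
    simp only [Function.comp_apply]
    linear_combination mul_norm_sq_sub_le_penalizedQuadratic_sub hwp.coercive hwp.sub_le w u
  obtain ⟨u, hu⟩ := hcont.exists_forall_le hcoercive
  exact ⟨u, fun v _ => hu v⟩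

theorem tendsto_sub_of_isMinOn {ι : Type*} {l : Filter ι} {A A' : ι → E →L[ℝ] E}
    {w w' u u' : ι → E} {h h' : ι → E → ℝ} {K : ℝ} (hc : 0 < c) (hL : 0 ≤ L)
    (hwp : ∀ᶠ i in l, IsWellPosed c L (A i) (h i))
    (hwp' : ∀ᶠ i in l, IsWellPosed c L (A' i) (h' i)) (hw : ∀ᶠ i in l, ‖w i‖ ≤ K)
    (hw' : ∀ᶠ i in l, ‖w' i‖ ≤ K) (hAA' : Tendsto (fun i => A i - A' i) l (𝓝 0))
    (hww' : Tendsto (fun i => w i - w' i) l (𝓝 0))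
    (hhh' : ∀ R : ℝ, Tendsto (fun q : ι × E => h q.1 q.2 - h' q.1 q.2)
      (l ×ˢ 𝓟 (Metric.closedBall 0 R)) (𝓝 0))
    (hu : ∀ᶠ i in l, IsMinOn (penalizedQuadratic (A i) (w i) (h i)) Set.univ (u i))
    (hu' : ∀ᶠ i in l, IsMinOn (penalizedQuadratic (A' i) (w' i) (h' i)) Set.univ (u' i)) :
    Tendsto (fun i => u' i - u i) l (𝓝 0) := by
  set R := (2 * K + L) / c
  have hR : ∀ {x : ℝ}, x ≤ K → (2 * x + L) / c ≤ R := fun hx => by simp only [R]; gcongr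
  have huR : ∀ᶠ i in l, ‖u i‖ ≤ R := by
    filter_upwards [hwp, hw, hu] with i hwpi hwi hui
    exact (hwpi.norm_le_of_isMinOn hc hL hui).trans (hR hwi)
  have huR' : ∀ᶠ i in l, ‖u' i‖ ≤ R := by
    filter_upwards [hwp', hw', hu'] with i hwpi hwi hui
    exact (hwpi.norm_le_of_isMinOn hc hL hui).trans (hR hwi)
  have hpenalty : ∀ v : ι → E, (∀ᶠ i in l, ‖v i‖ ≤ R) →
      Tendsto (fun i => |h i (v i) - h' i (v i)|) l (𝓝 0) := fun v hv => by
    have hball : Tendsto (fun i => (i, v i)) l (l ×ˢ 𝓟 (Metric.closedBall 0 R)) :=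
      tendsto_id.prodMk (tendsto_principal.2 (by simpa only [mem_closedBall_zero_iff] using hv))
    simpa only [Function.comp_def, abs_zero] using ((hhh' R).comp hball).abs
  have hbound : Tendsto (fun i => 2 * ‖A i - A' i‖ * R ^ 2 + 4 * ‖w i - w' i‖ * R
      + |h i (u' i) - h' i (u' i)| + |h i (u i) - h' i (u i)|) l (𝓝 0) := by
    simpa using ((((hAA'.norm.const_mul 2).mul_const (R ^ 2)).add
      ((hww'.norm.const_mul 4).mul_const R)).add (hpenalty u' huR')).add (hpenalty u huR)
  have hsq : Tendsto (fun i => c * ‖u' i - u i‖ ^ 2) l (𝓝 0) := by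
    refine squeeze_zero' (Eventually.of_forall fun i => by positivity) ?_ hbound
    filter_upwards [hwp, hu, hu', huR, huR'] with i hwpi hui hui' huRi huRi'
    exact mul_sq_norm_sub_le_of_isMinOn_of_isMinOn hwpi.coercive hwpi.convexOn hui hui' huRi huRi'
  have hnorm := (hsq.const_mul c⁻¹).sqrt
  simp only [inv_mul_cancel_left₀ hc.ne', Real.sqrt_sq (norm_nonneg _), mul_zero,
    Real.sqrt_zero] at hnorm
  exact tendsto_zero_iff_norm_tendsto_zero.2 hnorm

end IsWellPosed

theorem exists_continuous_isMinOn [ProperSpace E] {T : Type*} [TopologicalSpace T] {w : T → E}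
    {h : T → E → ℝ} (hc : 0 < c) (hL : 0 ≤ L) (hwp : ∀ x, IsWellPosed c L A (h x))
    (hw : Continuous w)
    (hh : ∀ x, ∀ R : ℝ, Tendsto (fun q : T × E => h x q.2 - h q.1 q.2)
      (𝓝 x ×ˢ 𝓟 (Metric.closedBall 0 R)) (𝓝 0)) :
    ∃ F : T → E, Continuous F ∧
      ∀ x, IsMinOn (penalizedQuadratic A (w x) (h x)) Set.univ (F x) := by
  choose F hF using fun x => (hwp x).exists_isMinOn hc (w x)
  refine ⟨F, continuous_iff_continuousAt.2 fun x => ?_, hF⟩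
  have hbdd : ∀ᶠ y in 𝓝 x, ‖w y‖ ≤ ‖w x‖ + 1 :=
    (hw.norm.tendsto x).eventually_le_const (lt_add_one _)
  have hwsub : Tendsto (fun y => w x - w y) (𝓝 x) (𝓝 0) := by
    simpa only [sub_self] using (hw.tendsto x).const_sub (w x)
  refine tendsto_sub_nhds_zero_iff.1 (IsWellPosed.tendsto_sub_of_isMinOn hc hL
    (Eventually.of_forall fun _ => hwp x) (Eventually.of_forall hwp)
    (Eventually.of_forall fun _ => (lt_add_one ‖w x‖).le) hbdd ?_ hwsub (hh x)
    (Eventually.of_forall fun _ => hF x) (Eventually.of_forall hF))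
  simpa only [sub_self] using tendsto_const_nhds

end PenalizedQuadratic

section Penalties

variable {E : Type*} [AddCommGroup E] [Module ℝ E]

/-- Convex functions that are `1`-Lipschitz for the seminorm `N`. -/
structure IsConvexNonexpansive (N : Seminorm ℝ E) (Φ : E → ℝ) : Prop where
  convexOn : ConvexOn ℝ Set.univ Φ
  abs_sub_le : ∀ u v, |Φ u - Φ v| ≤ N (u - v)

/-- The increment of the seminorm `N` from `s • β` to `s • β + u`. The base value is written
`s * N β`, which is `N (s • β)` for `0 ≤ s` and makes the increment antitone in `s : ℝ`. -/
def localIncrement (N : Seminorm ℝ E) (β : E) (s : ℝ) (u : E) : ℝ :=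
  N (s • β + u) - s * N β

/-- The one-sided directional derivative of the seminorm `N` at `β` in the direction `u`, as the
infimum of the increments of `N` along `u` far out on the ray through `β`. -/
def directionalSlope (N : Seminorm ℝ E) (β u : E) : ℝ :=
  ⨅ s : ℝ, localIncrement N β s u

/-- The penalty of the rescaled Transfer Lasso: a multiple of a local sparsity penalty `Φ` and a
multiple of the distance, for the seminorm `N`, to a centre `d`. -/
def transferPenalty (N : Seminorm ℝ E) (Φ : E → ℝ) (a b : ℝ) (d u : E) : ℝ :=
  a * Φ u + b * N (u - d)

variable {N : Seminorm ℝ E} {Φ : E → ℝ}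

lemma IsConvexNonexpansive.abs_le (hΦ : IsConvexNonexpansive N Φ) (u : E) :
    |Φ u| ≤ |Φ 0| + N u := by
  have hle := (abs_sub_abs_le_abs_sub (Φ u) (Φ 0)).trans (hΦ.abs_sub_le u 0)
  rw [sub_zero] at hle
  linear_combination hle

lemma antitone_localIncrement (N : Seminorm ℝ E) (β u : E) :
    Antitone fun s => localIncrement N β s u := by
  intro s t hst
  have hsplit : t • β + u = (s • β + u) + (t - s) • β := by module
  have hle := map_add_le_add N (s • β + u) ((t - s) • β)
  rw [← hsplit, map_smul_eq_mul, Real.norm_of_nonneg (sub_nonneg.2 hst)] at hle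
  simp only [localIncrement]
  linear_combination hle

lemma bddBelow_range_localIncrement (N : Seminorm ℝ E) (β u : E) :
    BddBelow (Set.range fun s => localIncrement N β s u) := by
  refine ⟨-N u, ?_⟩
  rintro _ ⟨s, rfl⟩
  have hle := map_sub_le_add N (s • β + u) u
  rw [add_sub_cancel_right, map_smul_eq_mul, Real.norm_eq_abs] at hle
  simp only [localIncrement]
  linear_combination hle + mul_le_mul_of_nonneg_right (le_abs_self s) (apply_nonneg N β)

lemma tendsto_localIncrement (N : Seminorm ℝ E) (β u : E) :
    Tendsto (fun s => localIncrement N β s u) atTop (𝓝 (directionalSlope N β u)) :=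
  tendsto_atTop_ciInf (antitone_localIncrement N β u) (bddBelow_range_localIncrement N β u)

lemma isConvexNonexpansive_localIncrement (N : Seminorm ℝ E) (β : E) (s : ℝ) :
    IsConvexNonexpansive N (localIncrement N β s) where
  convexOn := (N.convexOn.translate_right (s • β)).add_const (-(s * N β))
  abs_sub_le u v := by
    simpa [localIncrement] using abs_sub_map_le_sub N (s • β + u) (s • β + v)

lemma isConvexNonexpansive_directionalSlope (N : Seminorm ℝ E) (β : E) :
    IsConvexNonexpansive N (directionalSlope N β) where
  convexOn := by
    refine ⟨convex_univ, fun u _ v _ t r ht hr htr => ?_⟩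
    exact le_of_tendsto_of_tendsto' (tendsto_localIncrement N β _)
      (((tendsto_localIncrement N β u).const_smul t).add
        ((tendsto_localIncrement N β v).const_smul r)) fun s =>
      (isConvexNonexpansive_localIncrement N β s).convexOn.2 (Set.mem_univ u) (Set.mem_univ v)
        ht hr htr
  abs_sub_le u v :=
    le_of_tendsto' ((tendsto_localIncrement N β u).sub (tendsto_localIncrement N β v)).abs
      fun s => (isConvexNonexpansive_localIncrement N β s).abs_sub_le u v

lemma directionalSlope_sub_smul (N : Seminorm ℝ E) (β u : E) (t : ℝ) :
    directionalSlope N β (u - t • β) = directionalSlope N β u - t * N β := by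
  have hshift : ∀ s, localIncrement N β s (u - t • β) =
      localIncrement N β (s - t) u - t * N β := fun s => by
    have hpoint : s • β + (u - t • β) = (s - t) • β + u := by module
    simp only [localIncrement, hpoint]
    ring
  refine tendsto_nhds_unique (tendsto_localIncrement N β _) ?_
  simp only [hshift]
  exact ((tendsto_localIncrement N β u).comp (tendsto_atTop_add_const_right _ (-t)
    tendsto_id)).sub_const _

lemma transferPenalty_sub_le (hΦ : IsConvexNonexpansive N Φ) {a b : ℝ} (ha : 0 ≤ a) (hb : 0 ≤ b)
    (d u v : E) :
    transferPenalty N Φ a b d u - transferPenalty N Φ a b d v ≤ (a + b) * N (u - v) := by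
  have hcentre := map_add_le_add N (u - v) (v - d)
  rw [sub_add_sub_cancel] at hcentre
  simp only [transferPenalty]
  linear_combination mul_le_mul_of_nonneg_left ((le_abs_self _).trans (hΦ.abs_sub_le u v)) ha +
    mul_le_mul_of_nonneg_left hcentre hb

lemma add_le_transferPenalty (hΦ : IsConvexNonexpansive N Φ) {a b : ℝ} (ha : 0 ≤ a) (d u : E) :
    transferPenalty N Φ a b d d + (b - a) * N (u - d) ≤ transferPenalty N Φ a b d u := by
  simp only [transferPenalty, sub_self, map_zero]
  linear_combination mul_le_mul_of_nonneg_left (abs_le.1 (hΦ.abs_sub_le u d)).1 ha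

lemma convexOn_transferPenalty (hΦ : ConvexOn ℝ Set.univ Φ) {a b : ℝ} (ha : 0 ≤ a) (hb : 0 ≤ b)
    (d : E) : ConvexOn ℝ Set.univ (transferPenalty N Φ a b d) := by
  have hdist : ConvexOn ℝ Set.univ fun u => N (u - d) := by
    simpa only [sub_eq_add_neg, Function.comp_def, Set.preimage_univ]
      using N.convexOn.translate_left (-d)
  exact (hΦ.smul ha).add (hdist.smul hb)

end Penalties

section UniformPenalties

variable {E : Type*} [NormedAddCommGroup E]

lemma IsConvexNonexpansive.continuous [NormedSpace ℝ E] {N : Seminorm ℝ E} (hN : Continuous N)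
    {Φ : E → ℝ} (hΦ : IsConvexNonexpansive N Φ) : Continuous Φ := by
  obtain ⟨M, -, hM⟩ := N.bound_of_continuous_normedSpace hN
  exact (LipschitzWith.of_dist_le' fun u v => by
    simpa only [dist_eq_norm, Real.norm_eq_abs] using (hΦ.abs_sub_le u v).trans (hM _)).continuous

lemma tendsto_directionalSlope_sub_localIncrement [NormedSpace ℝ E] [ProperSpace E]
    {N : Seminorm ℝ E} (hN : Continuous N) (β : E) (R : ℝ) :
    Tendsto (fun q : ℝ × E => directionalSlope N β q.2 - localIncrement N β q.1 q.2)
      (atTop ×ˢ 𝓟 (Metric.closedBall 0 R)) (𝓝 0) := by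
  have hdini : TendstoUniformlyOn (localIncrement N β) (directionalSlope N β) atTop
      (Metric.closedBall 0 R) :=
    Antitone.tendstoUniformlyOn_of_forall_tendsto (isCompact_closedBall 0 R)
      (fun s => ((isConvexNonexpansive_localIncrement N β s).continuous hN).continuousOn)
      (fun u _ => antitone_localIncrement N β u)
      ((isConvexNonexpansive_directionalSlope N β).continuous hN).continuousOn
      fun u _ => tendsto_localIncrement N β u
  rw [tendstoUniformlyOn_iff_tendsto, tendsto_uniformity_iff_dist_tendsto_zero] at hdini
  exact tendsto_zero_iff_abs_tendsto_zero _ |>.2 hdini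

lemma tendsto_transferPenalty_sub [NormedSpace ℝ E] {N : Seminorm ℝ E} (hN : Continuous N)
    {ι : Type*} {l : Filter ι} {Φ₀ : E → ℝ} (hΦ₀ : IsConvexNonexpansive N Φ₀) {Φ : ι → E → ℝ}
    {a b : ι → ℝ} {a₀ b₀ : ℝ} {d d' : ι → E} {K R : ℝ} (ha : Tendsto a l (𝓝 a₀))
    (hb : Tendsto b l (𝓝 b₀)) (hd : ∀ᶠ i in l, ‖d i‖ ≤ K)
    (hdd' : Tendsto (fun i => d i - d' i) l (𝓝 0))
    (hΦ : Tendsto (fun q : ι × E => Φ₀ q.2 - Φ q.1 q.2)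
      (l ×ˢ 𝓟 (Metric.closedBall 0 R)) (𝓝 0)) :
    Tendsto (fun q : ι × E => transferPenalty N Φ₀ a₀ b₀ (d' q.1) q.2 -
        transferPenalty N (Φ q.1) (a q.1) (b q.1) (d q.1) q.2)
      (l ×ˢ 𝓟 (Metric.closedBall 0 R)) (𝓝 0) := by
  obtain ⟨M, hM₀, hM⟩ := N.bound_of_continuous_normedSpace hN
  have hball : ∀ᶠ q : ι × E in l ×ˢ 𝓟 (Metric.closedBall 0 R), ‖q.2‖ ≤ R :=
    tendsto_snd.eventually (eventually_principal.2 fun u hu => mem_closedBall_zero_iff.1 hu)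
  have hΦ₀_bdd : IsBoundedUnder (· ≤ ·) (l ×ˢ 𝓟 (Metric.closedBall 0 R))
      ((‖·‖) ∘ fun q : ι × E => Φ₀ q.2) := by
    refine isBoundedUnder_of_eventually_le (a := |Φ₀ 0| + M * R) (hball.mono fun q hq => ?_)
    exact (hΦ₀.abs_le q.2).trans (by gcongr; exact (hM _).trans (by gcongr))
  have hN_bdd : IsBoundedUnder (· ≤ ·) (l ×ˢ 𝓟 (Metric.closedBall 0 R))
      ((‖·‖) ∘ fun q : ι × E => N (q.2 - d q.1)) := by
    refine isBoundedUnder_of_eventually_le (a := M * (R + K)) ?_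
    filter_upwards [hball, tendsto_fst.eventually hd] with q hq hdq
    rw [Function.comp_apply, Real.norm_of_nonneg (apply_nonneg N _)]
    exact (hM _).trans (by gcongr; exact norm_sub_le_of_le hq hdq)
  have hcentre : Tendsto (fun q : ι × E => N (q.2 - d' q.1) - N (q.2 - d q.1))
      (l ×ˢ 𝓟 (Metric.closedBall 0 R)) (𝓝 0) := by
    have hNd : Tendsto (fun q : ι × E => N (d q.1 - d' q.1))
        (l ×ˢ 𝓟 (Metric.closedBall 0 R)) (𝓝 0) := by
      simpa only [map_zero, Function.comp_def] using (hN.tendsto 0).comp (hdd'.comp tendsto_fst)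
    refine squeeze_zero_norm (fun q => ?_) hNd
    simpa only [sub_sub_sub_cancel_left, Real.norm_eq_abs]
      using abs_sub_map_le_sub N (q.2 - d' q.1) (q.2 - d q.1)
  have ha' : Tendsto (fun q : ι × E => a₀ - a q.1) (l ×ˢ 𝓟 (Metric.closedBall 0 R)) (𝓝 0) := by
    simpa only [sub_self, Function.comp_def] using (ha.comp tendsto_fst).const_sub a₀
  have hb' : Tendsto (fun q : ι × E => b₀ - b q.1) (l ×ˢ 𝓟 (Metric.closedBall 0 R)) (𝓝 0) := by
    simpa only [sub_self, Function.comp_def] using (hb.comp tendsto_fst).const_sub b₀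
  have hsum := (((ha'.zero_mul_isBoundedUnder_le hΦ₀_bdd).add ((ha.comp tendsto_fst).mul hΦ)).add
    (hb'.zero_mul_isBoundedUnder_le hN_bdd)).add (hcentre.const_mul b₀)
  simp only [mul_zero, add_zero] at hsum
  refine hsum.congr fun q => ?_
  simp only [transferPenalty, Function.comp_apply]
  ring

lemma isWellPosed_transferPenalty [InnerProductSpace ℝ E] {N : Seminorm ℝ E} {M : ℝ}
    (hM : ∀ v, N v ≤ M * ‖v‖) {Φ : E → ℝ} (hΦ : IsConvexNonexpansive N Φ)
    {A : E →L[ℝ] E} {c : ℝ} (hA : ∀ v, c * ‖v‖ ^ 2 ≤ ⟪A v, v⟫) {a b K : ℝ} (ha : 0 ≤ a)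
    (hb : 0 ≤ b) (hK : a + b ≤ K) (d : E) :
    IsWellPosed c (K * M) A (transferPenalty N Φ a b d) where
  coercive := hA
  convexOn := convexOn_transferPenalty hΦ.convexOn ha hb d
  abs_sub_le u v := by
    have hbound : ∀ u v, transferPenalty N Φ a b d u - transferPenalty N Φ a b d v ≤
        K * M * ‖u - v‖ := fun u v =>
      calc _ ≤ (a + b) * N (u - v) := transferPenalty_sub_le hΦ ha hb d u v
        _ ≤ K * (M * ‖u - v‖) :=
          mul_le_mul hK (hM _) (apply_nonneg N _) ((add_nonneg ha hb).trans hK)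
        _ = K * M * ‖u - v‖ := (mul_assoc _ _ _).symm
    exact abs_sub_le_iff.2 ⟨hbound u v, norm_sub_rev u v ▸ hbound v u⟩

end UniformPenalties

section Probability

variable {Ω Ω' E F : Type*} [NormedAddCommGroup E]

/-- The filter of statements about `(n, ω)` that hold, for all large `n`, at every `ω` with
`‖V n ω‖ ≤ K`. Limits along it are limits in `n`, uniform on the event `‖V n‖ ≤ K`. -/
def atTopBoundedBy (V : ℕ → Ω → E) (K : ℝ) : Filter (ℕ × Ω) :=
  comap Prod.fst atTop ⊓ 𝓟 {x | ‖V x.1 x.2‖ ≤ K}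

lemma tendsto_fst_atTopBoundedBy (V : ℕ → Ω → E) (K : ℝ) :
    Tendsto Prod.fst (atTopBoundedBy V K) atTop :=
  tendsto_comap.mono_left inf_le_left

lemma eventually_norm_le_atTopBoundedBy (V : ℕ → Ω → E) (K : ℝ) :
    ∀ᶠ x in atTopBoundedBy V K, ‖V x.1 x.2‖ ≤ K :=
  mem_inf_of_right (mem_principal_self _)

lemma eventually_atTopBoundedBy_iff {V : ℕ → Ω → E} {K : ℝ} {q : ℕ × Ω → Prop} :
    (∀ᶠ x in atTopBoundedBy V K, q x) ↔ ∀ᶠ n in atTop, ∀ ω, ‖V n ω‖ ≤ K → q (n, ω) := by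
  rw [atTopBoundedBy, eventually_inf_principal, eventually_comap]
  exact eventually_congr (Eventually.of_forall fun n =>
    ⟨fun hq ω => hq (n, ω) rfl, by rintro hq ⟨_, ω⟩ rfl; exact hq ω⟩)

variable [MeasurableSpace Ω] {P : Measure Ω} [IsProbabilityMeasure P]

lemma tendstoInMeasure_zero_of_forall_tendsto_atTopBoundedBy [NormedAddCommGroup F]
    {V : ℕ → Ω → E} (hV : IsBoundedInProbability P V) {Y : ℕ → Ω → F}
    (hY : ∀ K, Tendsto (fun x : ℕ × Ω => Y x.1 x.2) (atTopBoundedBy V K) (𝓝 0)) :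
    TendstoInMeasure P Y atTop 0 := by
  refine tendstoInMeasure_iff_measureReal_norm.2 fun δ hδ => ?_
  refine tendsto_order.2 ⟨fun x hx => Eventually.of_forall fun n =>
    hx.trans_le measureReal_nonneg, fun τ hτ => ?_⟩
  obtain ⟨K, hK⟩ := hV (τ / 2) (half_pos hτ)
  have hsmall := eventually_atTopBoundedBy_iff.1
    ((tendsto_zero_iff_norm_tendsto_zero.1 (hY K)).eventually_lt_const hδ)
  filter_upwards [hK, hsmall] with n htail hn
  have hsubset : {ω | δ ≤ ‖Y n ω - (0 : Ω → F) ω‖} ⊆ {ω | K < ‖V n ω‖} := fun ω hω => by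
    by_contra hle
    refine absurd (hn ω (not_lt.1 hle)) (not_lt.2 ?_)
    simpa using hω
  exact ((measureReal_mono hsubset).trans htail).trans_lt (half_lt_self hτ)

lemma tendstoInMeasure_const_of_tendsto {x : ℕ → E} {y : E} (h : Tendsto x atTop (𝓝 y)) :
    TendstoInMeasure P (fun n (_ : Ω) => x n) atTop fun _ => y :=
  tendstoInMeasure_of_tendsto_ae (fun _ => aestronglyMeasurable_const) (ae_of_all _ fun _ => h)

lemma not_isBoundedInProbability_smul [NormedSpace ℝ E] {Y : ℕ → Ω → E} {y : E} (hy : y ≠ 0)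
    {a r : ℕ → ℝ} (h : TendstoInMeasure P (fun n ω => a n • Y n ω) atTop fun _ => y)
    (hra : Tendsto (fun n => r n / a n) atTop atTop) :
    ¬ IsBoundedInProbability P fun n ω => r n • Y n ω := by
  intro hbdd
  obtain ⟨K, hK⟩ := hbdd (1 / 2) one_half_pos
  have hy' : 0 < ‖y‖ / 2 := half_pos (norm_pos_iff.2 hy)
  have hclose := (tendstoInMeasure_iff_measureReal_norm.1 h (‖y‖ / 2) hy').eventually_lt_const
    (one_half_pos (α := ℝ))
  obtain ⟨n, hKn, hcn, hpos, hlarge⟩ := (hK.and (hclose.and ((hra.eventually_gt_atTop 0).and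
    ((hra.atTop_mul_const hy').eventually_gt_atTop K)))).exists
  have hcover : (Set.univ : Set Ω) ⊆
      {ω | K < ‖r n • Y n ω‖} ∪ {ω | ‖y‖ / 2 ≤ ‖a n • Y n ω - y‖} := by
    refine fun ω _ => or_iff_not_imp_right.2 fun hfar => ?_
    have hnear : ‖a n • Y n ω - y‖ < ‖y‖ / 2 := not_le.1 hfar
    have hhalf : ‖y‖ / 2 ≤ ‖a n • Y n ω‖ := by
      linarith [norm_sub_norm_le y (a n • Y n ω), norm_sub_rev y (a n • Y n ω)]
    calc K < r n / a n * (‖y‖ / 2) := hlarge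
      _ ≤ r n / a n * ‖a n • Y n ω‖ := by gcongr
      _ = ‖r n • Y n ω‖ := by
        rw [← Real.norm_of_nonneg hpos.le, ← norm_smul, smul_smul,
          div_mul_cancel₀ _ (div_ne_zero_iff.1 hpos.ne').2]
  have hone := (measureReal_mono (μ := P) hcover).trans (measureReal_union_le _ _)
  rw [probReal_univ] at hone
  linarith

variable [MeasurableSpace Ω'] {P' : Measure Ω'} [IsProbabilityMeasure P'] [MeasurableSpace E]
  [BorelSpace E]

lemma eventually_measure_preimage_lt_of_tendstoInDistribution {Y : ℕ → Ω → E} {Z : Ω' → E}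
    (h : TendstoInDistribution Y atTop Z (fun _ => P) P') {S : Set E} (hS : IsClosed S)
    {δ : ENNReal} (hδ : P' (Z ⁻¹' S) < δ) : ∀ᶠ n in atTop, P (Y n ⁻¹' S) < δ := by
  have hlimsup := ProbabilityMeasure.limsup_measure_closed_le_of_tendsto h.tendsto hS
  simp only [ProbabilityMeasure.coe_mk] at hlimsup
  rw [Measure.map_apply_of_aemeasurable h.aemeasurable_limit hS.measurableSet] at hlimsup
  filter_upwards [eventually_lt_of_limsup_lt (hlimsup.trans_lt hδ)] with n hn
  rwa [Measure.map_apply_of_aemeasurable (h.forall_aemeasurable n) hS.measurableSet] at hn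

lemma tendsto_measure_norm_ge_atTop {Z : Ω' → E} (hZ : AEMeasurable Z P') :
    Tendsto (fun k : ℕ => P' {ω | (k : ℝ) ≤ ‖Z ω‖}) atTop (𝓝 0) := by
  have hempty : (⋂ k : ℕ, {ω | (k : ℝ) ≤ ‖Z ω‖}) = ∅ := by
    refine Set.eq_empty_of_forall_notMem fun ω hω => ?_
    obtain ⟨k, hk⟩ := exists_nat_gt ‖Z ω‖
    exact absurd (Set.mem_iInter.1 hω k) (not_le.2 hk)
  rw [← measure_empty (μ := P'), ← hempty]
  refine tendsto_measure_iInter_atTop (fun k => ?_)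
    (fun i j hij ω (hω : (j : ℝ) ≤ ‖Z ω‖) => (Nat.cast_le.2 hij).trans hω)
    ⟨0, measure_ne_top _ _⟩
  exact nullMeasurableSet_le aemeasurable_const hZ.norm

lemma isBoundedInProbability_of_tendstoInDistribution {Y : ℕ → Ω → E} {Z : Ω' → E}
    (h : TendstoInDistribution Y atTop Z (fun _ => P) P') :
    IsBoundedInProbability P Y := by
  intro δ hδ
  obtain ⟨k, hk⟩ := ((tendsto_measure_norm_ge_atTop h.aemeasurable_limit).eventually_lt_const
    (ENNReal.ofReal_pos.2 hδ)).exists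
  refine ⟨k, ?_⟩
  filter_upwards [eventually_measure_preimage_lt_of_tendstoInDistribution h
    (isClosed_le continuous_const continuous_norm) hk] with n hn
  exact ENNReal.toReal_le_of_le_ofReal hδ.le
    ((measure_mono fun ω (hω : (k : ℝ) < ‖Y n ω‖) => hω.le).trans hn.le)

lemma tendstoInMeasure_of_tendstoInDistribution_const {Y : ℕ → Ω → E} {y : E}
    (h : TendstoInDistribution Y atTop (fun _ : Ω' => y) (fun _ => P) P') :
    TendstoInMeasure P Y atTop fun _ => y := by
  refine tendstoInMeasure_iff_norm.2 fun δ hδ => ENNReal.tendsto_nhds_zero.2 fun τ hτ => ?_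
  have hclosed : IsClosed {x : E | δ ≤ ‖x - y‖} :=
    isClosed_le continuous_const (continuous_id.sub continuous_const).norm
  have hempty : (fun _ : Ω' => y) ⁻¹' {x : E | δ ≤ ‖x - y‖} = ∅ :=
    Set.preimage_const_of_notMem (by simpa using hδ)
  refine (eventually_measure_preimage_lt_of_tendstoInDistribution h hclosed (δ := τ) ?_).mono
    fun n hn => hn.le
  rwa [hempty, measure_empty]

lemma tendstoInDistribution_id_map {Y : ℕ → Ω → E} {Z : Ω' → E}
    (h : TendstoInDistribution Y atTop Z (fun _ => P) P') [IsProbabilityMeasure (P'.map Z)] :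
    TendstoInDistribution Y atTop id (fun _ => P) (P'.map Z) where
  forall_aemeasurable := h.forall_aemeasurable
  aemeasurable_limit := aemeasurable_id
  tendsto := by
    convert! h.tendsto using 2
    exact congrArg 𝓝 (Subtype.ext Measure.map_id)

lemma tendstoInDistribution_prodMk_of_indepFun [SecondCountableTopology E]
    [NormedAddCommGroup F] [MeasurableSpace F] [BorelSpace F] [SecondCountableTopology F]
    {Y : ℕ → Ω → E} {Y' : ℕ → Ω → F} {μ : Measure E} [IsProbabilityMeasure μ] {μ' : Measure F}
    [IsProbabilityMeasure μ'] (h : TendstoInDistribution Y atTop id (fun _ => P) μ)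
    (h' : TendstoInDistribution Y' atTop id (fun _ => P) μ')
    (hind : ∀ n, IndepFun (Y n) (Y' n) P) :
    TendstoInDistribution (fun n ω => (Y n ω, Y' n ω)) atTop id (fun _ => P) (μ.prod μ') where
  forall_aemeasurable n := (h.forall_aemeasurable n).prodMk (h'.forall_aemeasurable n)
  aemeasurable_limit := aemeasurable_id
  tendsto := by
    have hprod := (ProbabilityMeasure.continuous_prod.tendsto (_, _)).comp
      (h.tendsto.prodMk_nhds h'.tendsto)
    convert! hprod using 2
    · refine congrArg (fun f => Tendsto f) (funext fun n => Subtype.ext ?_)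
      exact (indepFun_iff_map_prod_eq_prod_map_map (h.forall_aemeasurable n)
        (h'.forall_aemeasurable n)).1 (hind n)
    · refine congrArg 𝓝 (Subtype.ext ?_)
      change Measure.map id (μ.prod μ') = (Measure.map id μ).prod (Measure.map id μ')
      simp only [Measure.map_id]

section Rates

variable [NormedSpace ℝ E] {err : ℕ → Ω → E} {a : ℕ → ℝ} {Z : Ω' → E}

lemma convergesAtRate_of_tendstoInDistribution
    (h : TendstoInDistribution (fun n ω => a n • err n ω) atTop Z (fun _ => P) P') :
    ConvergesAtRate P err a :=
  have := Measure.isProbabilityMeasure_map h.aemeasurable_limit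
  ⟨⟨P'.map Z, this⟩, tendstoInDistribution_id_map h⟩

lemma hasConvergenceRate_of_tendstoInDistribution
    (h : TendstoInDistribution (fun n ω => a n • err n ω) atTop Z (fun _ => P) P')
    (hne : ¬ ∀ᵐ ω ∂P', Z ω = 0) : HasConvergenceRate P err a := by
  have := Measure.isProbabilityMeasure_map h.aemeasurable_limit
  refine ⟨⟨P'.map Z, this⟩, tendstoInDistribution_id_map h,
    fun (hdirac : P'.map Z = Measure.dirac 0) => ?_⟩
  have hzero : ∀ᵐ x ∂(P'.map Z), x ∈ ({0} : Set E) := by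
    rw [hdirac]
    exact (ae_dirac_iff (p := (· ∈ ({0} : Set E))) (measurableSet_singleton 0)).2 rfl
  exact hne (ae_of_ae_map h.aemeasurable_limit hzero)

end Rates

end Probability

section ArgminTheorem

variable {E : Type*} [NormedAddCommGroup E] [InnerProductSpace ℝ E]

lemma eventually_coercive {ι : Type*} {l : Filter ι} {A : ι → E →L[ℝ] E} {A₀ : E →L[ℝ] E}
    {c c' : ℝ} (hA : Tendsto A l (𝓝 A₀)) (hA₀ : ∀ v, c * ‖v‖ ^ 2 ≤ ⟪A₀ v, v⟫) (hc : c' < c) :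
    ∀ᶠ i in l, ∀ v, c' * ‖v‖ ^ 2 ≤ ⟪A i v, v⟫ := by
  have hnear : ∀ᶠ i in l, ‖A₀ - A i‖ < c - c' := by
    have hsub := (hA.const_sub A₀).norm
    rw [sub_self, norm_zero] at hsub
    exact hsub.eventually_lt_const (sub_pos.2 hc)
  filter_upwards [hnear] with i hi v
  have hdiff : ⟪(A₀ - A i) v, v⟫ ≤ (c - c') * ‖v‖ * ‖v‖ :=
    (le_abs_self _).trans ((abs_inner_apply_le _ v v).trans (by gcongr))
  simp only [sub_apply, inner_sub_left] at hdiff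
  linear_combination hdiff + hA₀ v

variable {N : Seminorm ℝ E} {A₀ : E →L[ℝ] E} {c a₀ b₀ : ℝ} {Φ₀ : E → ℝ}

lemma exists_continuous_isMinOn_transferPenalty [ProperSpace E] (hN : Continuous N) (hc : 0 < c)
    (hA₀ : ∀ v, c * ‖v‖ ^ 2 ≤ ⟪A₀ v, v⟫) (hΦ₀ : IsConvexNonexpansive N Φ₀) (ha₀ : 0 ≤ a₀)
    (hb₀ : 0 ≤ b₀) :
    ∃ F : E × E → E, Continuous F ∧ ∀ x : E × E,
      IsMinOn (penalizedQuadratic A₀ x.1 (transferPenalty N Φ₀ a₀ b₀ x.2)) Set.univ (F x) := by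
  obtain ⟨M, hM₀, hM⟩ := N.bound_of_continuous_normedSpace hN
  refine exists_continuous_isMinOn hc (mul_nonneg (add_nonneg ha₀ hb₀) hM₀.le)
    (fun x => isWellPosed_transferPenalty hM hΦ₀ hA₀ ha₀ hb₀ le_rfl x.2) continuous_fst
    fun x R => ?_
  have hbdd : ∀ᶠ y : E × E in 𝓝 x, ‖y.2‖ ≤ ‖x.2‖ + 1 :=
    (continuous_snd.norm.tendsto x).eventually_le_const (lt_add_one _)
  have hcentre : Tendsto (fun y : E × E => y.2 - x.2) (𝓝 x) (𝓝 0) := by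
    simpa only [sub_self] using (continuous_snd.tendsto x).sub_const x.2
  have hconst : Tendsto (fun q : (E × E) × E => Φ₀ q.2 - Φ₀ q.2)
      (𝓝 x ×ˢ 𝓟 (Metric.closedBall 0 R)) (𝓝 0) := by
    simpa only [sub_self] using tendsto_const_nhds
  exact tendsto_transferPenalty_sub (Φ := fun _ => Φ₀) (a := fun _ => a₀) (b := fun _ => b₀)
    (d := fun y : E × E => y.2) (d' := fun _ => x.2) hN hΦ₀ tendsto_const_nhds
    tendsto_const_nhds hbdd hcentre hconst

theorem tendsto_sub_of_isMinOn_transferPenalty {ι : Type*} {l : Filter ι} {A : ι → E →L[ℝ] E}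
    {a b : ι → ℝ} {Φ : ι → E → ℝ} {w d u u₀ : ι → E} {K : ℝ} (hN : Continuous N) (hc : 0 < c)
    (hA₀ : ∀ v, c * ‖v‖ ^ 2 ≤ ⟪A₀ v, v⟫) (hA : Tendsto A l (𝓝 A₀))
    (hΦ₀ : IsConvexNonexpansive N Φ₀) (hΦ : ∀ i, IsConvexNonexpansive N (Φ i))
    (hΦΦ₀ : ∀ R : ℝ, Tendsto (fun q : ι × E => Φ₀ q.2 - Φ q.1 q.2)
      (l ×ˢ 𝓟 (Metric.closedBall 0 R)) (𝓝 0))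
    (ha₀ : 0 ≤ a₀) (hb₀ : 0 ≤ b₀) (ha : Tendsto a l (𝓝 a₀)) (hb : Tendsto b l (𝓝 b₀))
    (ha_nonneg : ∀ᶠ i in l, 0 ≤ a i) (hb_nonneg : ∀ᶠ i in l, 0 ≤ b i)
    (hw : ∀ᶠ i in l, ‖w i‖ ≤ K) (hd : ∀ᶠ i in l, ‖d i‖ ≤ K)
    (hu₀ : ∀ᶠ i in l, IsMinOn
      (penalizedQuadratic A₀ (w i) (transferPenalty N Φ₀ a₀ b₀ (d i))) Set.univ (u₀ i))
    (hu : ∀ᶠ i in l, IsMinOn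
      (penalizedQuadratic (A i) (w i) (transferPenalty N (Φ i) (a i) (b i) (d i))) Set.univ (u i)) :
    Tendsto (fun i => u i - u₀ i) l (𝓝 0) := by
  obtain ⟨M, hM₀, hM⟩ := N.bound_of_continuous_normedSpace hN
  have hwp₀ : ∀ i, IsWellPosed (c / 2) ((a₀ + b₀ + 1) * M) A₀
      (transferPenalty N Φ₀ a₀ b₀ (d i)) := fun i =>
    isWellPosed_transferPenalty hM hΦ₀
      (fun v => (hA₀ v).trans' (by gcongr; exact half_le_self hc.le)) ha₀ hb₀ (lt_add_one _).le _
  have hwp : ∀ᶠ i in l, IsWellPosed (c / 2) ((a₀ + b₀ + 1) * M) (A i)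
      (transferPenalty N (Φ i) (a i) (b i) (d i)) := by
    filter_upwards [eventually_coercive hA hA₀ (half_lt_self hc), ha_nonneg, hb_nonneg,
      (ha.add hb).eventually_le_const (lt_add_one _)] with i hAi hai hbi habi
    exact isWellPosed_transferPenalty hM (hΦ i) hAi hai hbi habi (d i)
  have hself : ∀ v : ι → E, Tendsto (fun i => v i - v i) l (𝓝 0) := fun v => by
    simpa only [sub_self] using tendsto_const_nhds
  have hAA₀ : Tendsto (fun i => A₀ - A i) l (𝓝 0) := by
    simpa only [sub_self] using hA.const_sub A₀
  exact IsWellPosed.tendsto_sub_of_isMinOn (half_pos hc) (by positivity)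
    (Eventually.of_forall hwp₀) hwp hw hw hAA₀ (hself w)
    (fun R => tendsto_transferPenalty_sub hN hΦ₀ ha hb hd (hself d) (hΦΦ₀ R)) hu₀ hu

variable {Ω Ω' : Type*} [MeasurableSpace Ω] {P : Measure Ω} [IsProbabilityMeasure P]
  [MeasurableSpace Ω'] {P' : Measure Ω'} [IsProbabilityMeasure P'] [MeasurableSpace E]
  [BorelSpace E] {A : ℕ → E →L[ℝ] E} {a b : ℕ → ℝ} {Φ : ℕ → E → ℝ}

theorem tendstoInDistribution_of_isMinOn [SecondCountableTopology E] {W D U : ℕ → Ω → E}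
    {Z : Ω' → E × E} {F : E × E → E}
    (hN : Continuous N) (hc : 0 < c) (hA₀ : ∀ v, c * ‖v‖ ^ 2 ≤ ⟪A₀ v, v⟫)
    (hA : Tendsto A atTop (𝓝 A₀)) (hΦ₀ : IsConvexNonexpansive N Φ₀)
    (hΦ : ∀ n, IsConvexNonexpansive N (Φ n))
    (hΦΦ₀ : ∀ R : ℝ, Tendsto (fun q : ℕ × E => Φ₀ q.2 - Φ q.1 q.2)
      (atTop ×ˢ 𝓟 (Metric.closedBall 0 R)) (𝓝 0))
    (ha : Tendsto a atTop (𝓝 a₀)) (hb : Tendsto b atTop (𝓝 b₀))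
    (ha_nonneg : ∀ᶠ n in atTop, 0 ≤ a n) (hb_nonneg : ∀ᶠ n in atTop, 0 ≤ b n)
    (hWD : TendstoInDistribution (fun n ω => (W n ω, D n ω)) atTop Z (fun _ => P) P')
    (hU : ∀ n, AEMeasurable (U n) P)
    (hUmin : ∀ᶠ n in atTop, ∀ ω, IsMinOn (penalizedQuadratic (A n) (W n ω)
      (transferPenalty N (Φ n) (a n) (b n) (D n ω))) Set.univ (U n ω))
    (hF : Continuous F) (hFmin : ∀ x : E × E,
      IsMinOn (penalizedQuadratic A₀ x.1 (transferPenalty N Φ₀ a₀ b₀ x.2)) Set.univ (F x)) :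
    TendstoInDistribution U atTop (F ∘ Z) (fun _ => P) P' := by
  refine tendstoInDistribution_of_tendstoInMeasure_sub _ _ (hWD.continuous_comp hF) ?_ hU
  refine tendstoInMeasure_zero_of_forall_tendsto_atTopBoundedBy
    (isBoundedInProbability_of_tendstoInDistribution hWD) fun K => ?_
  have hfst : Tendsto Prod.fst (atTopBoundedBy (fun n ω => (W n ω, D n ω)) K) atTop :=
    tendsto_fst_atTopBoundedBy _ K
  have hbdd := eventually_norm_le_atTopBoundedBy (fun n ω => (W n ω, D n ω)) K
  exact tendsto_sub_of_isMinOn_transferPenalty (w := fun x : ℕ × Ω => W x.1 x.2)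
    (d := fun x => D x.1 x.2) (u := fun x => U x.1 x.2) (u₀ := fun x => F (W x.1 x.2, D x.1 x.2))
    (Φ := fun x : ℕ × Ω => Φ x.1) hN hc hA₀ (hA.comp hfst) hΦ₀ (fun x => hΦ x.1)
    (fun R => (hΦΦ₀ R).comp (hfst.prodMap tendsto_id)) (ge_of_tendsto ha ha_nonneg)
    (ge_of_tendsto hb hb_nonneg) (ha.comp hfst) (hb.comp hfst) (hfst.eventually ha_nonneg)
    (hfst.eventually hb_nonneg) (hbdd.mono fun x hx => (norm_fst_le _).trans hx)
    (hbdd.mono fun x hx => (norm_snd_le _).trans hx)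
    (Eventually.of_forall fun x => hFmin (W x.1 x.2, D x.1 x.2))
    ((hfst.eventually hUmin).mono fun x hx => hx x.2)

end ArgminTheorem

section Regression

variable {ι : Type*} {n : ℕ}

/-- The score `n^{-1/2} Xᵀ e` of a linear regression with design `X` and noise `e`. -/
def normalizedScore (X : Matrix (Fin n) ι ℝ) (e : Fin n → ℝ) : EuclideanSpace ℝ ι :=
  WithLp.toLp 2 ((1 / √(n : ℝ)) • (Xᵀ *ᵥ e))

lemma continuous_normalizedScore (X : Matrix (Fin n) ι ℝ) : Continuous (normalizedScore X) := by
  unfold normalizedScore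
  fun_prop

variable [Fintype ι]

/-- The `ℓ¹` norm, as a seminorm on Euclidean space. -/
def l1Seminorm (ι : Type*) [Fintype ι] : Seminorm ℝ (EuclideanSpace ℝ ι) :=
  Seminorm.of (fun u => ∑ j, |u j|)
    (fun u v => by
      rw [← Finset.sum_add_distrib]
      exact Finset.sum_le_sum fun j _ => abs_add_le (u j) (v j))
    (fun r u => by simp [abs_mul, Finset.mul_sum])

lemma l1Seminorm_apply (u : EuclideanSpace ℝ ι) : l1Seminorm ι u = ∑ j, |u j| := rfl

lemma continuous_l1Seminorm : Continuous (l1Seminorm ι) :=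
  continuous_finsetSum _ fun j _ => (EuclideanSpace.proj j).continuous.abs

lemma norm_le_l1Seminorm (u : EuclideanSpace ℝ ι) : ‖u‖ ≤ l1Seminorm ι u := by
  rw [EuclideanSpace.norm_eq]
  refine Real.sqrt_le_iff.2 ⟨apply_nonneg _ _, ?_⟩
  simpa [l1Seminorm_apply] using Finset.sum_sq_le_sq_sum_of_nonneg (s := Finset.univ)
    (f := fun j => |u j|) fun j _ => abs_nonneg _

lemma inner_normalizedScore (X : Matrix (Fin n) ι ℝ) (e : Fin n → ℝ) (u : EuclideanSpace ℝ ι) :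
    ⟪normalizedScore X e, u⟫ = 1 / √(n : ℝ) * ∑ i, e i * (X *ᵥ u.ofLp) i := by
  have hdot : ⟪normalizedScore X e, u⟫ = u.ofLp ⬝ᵥ ((1 / √(n : ℝ)) • (Xᵀ *ᵥ e)) := by
    simp [normalizedScore, EuclideanSpace.inner_eq_star_dotProduct]
  rw [hdot, dotProduct_smul, smul_eq_mul, Matrix.mulVec_transpose, dotProduct_comm,
    ← Matrix.dotProduct_mulVec]
  rfl

lemma inner_normalizedScore_eq_inner_toLp (X : Matrix (Fin n) ι ℝ) (e : Fin n → ℝ)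
    (t : EuclideanSpace ℝ ι) :
    ⟪normalizedScore X e, t⟫ =
      ⟪WithLp.toLp 2 e, WithLp.toLp 2 ((1 / √(n : ℝ)) • (X *ᵥ t.ofLp))⟫ := by
  rw [inner_normalizedScore, PiLp.inner_apply, Finset.mul_sum]
  refine Finset.sum_congr rfl fun i _ => ?_
  simp only [Pi.smul_apply, smul_eq_mul, Real.inner_apply]
  ring

variable [DecidableEq ι]

/-- The operator of the normalised Gram matrix `n⁻¹ Xᵀ X`. -/
def gramOperator (X : Matrix (Fin n) ι ℝ) : EuclideanSpace ℝ ι →L[ℝ] EuclideanSpace ℝ ι :=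
  Matrix.toEuclideanCLM (𝕜 := ℝ) ((1 / (n : ℝ)) • (Xᵀ * X))

lemma inner_gramOperator (X : Matrix (Fin n) ι ℝ) (u : EuclideanSpace ℝ ι) :
    ⟪gramOperator X u, u⟫ = 1 / (n : ℝ) * ∑ i, ((X *ᵥ u.ofLp) i) ^ 2 := by
  rw [real_inner_comm, gramOperator, Matrix.inner_toEuclideanCLM, Matrix.smul_mulVec,
    dotProduct_smul, smul_eq_mul, ← Matrix.mulVec_mulVec, Matrix.mulVec_transpose,
    dotProduct_comm, ← Matrix.dotProduct_mulVec]
  simp only [dotProduct, sq]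

lemma inner_gramOperator_nonneg (X : Matrix (Fin n) ι ℝ) (u : EuclideanSpace ℝ ι) :
    0 ≤ ⟪gramOperator X u, u⟫ := by
  rw [inner_gramOperator]
  positivity

lemma tendsto_gramOperator {X : (n : ℕ) → Matrix (Fin n) ι ℝ} {C : Matrix ι ι ℝ}
    (hX : Tendsto (fun n : ℕ => (1 / (n : ℝ)) • ((X n)ᵀ * X n)) atTop (𝓝 C)) :
    Tendsto (fun n => gramOperator (X n)) atTop (𝓝 (Matrix.toEuclideanCLM (𝕜 := ℝ) C)) :=
  ((LinearMap.continuous_of_finiteDimensional (IsLinearMap.mk' (Matrix.toEuclideanCLM (𝕜 := ℝ))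
    ⟨map_add _, map_smul _⟩)).tendsto C).comp hX

end Regression

section Coercivity

lemma exists_coercive_of_pos {E : Type*} [NormedAddCommGroup E] [InnerProductSpace ℝ E]
    [ProperSpace E] {A : E →L[ℝ] E} (hA : ∀ v, v ≠ 0 → 0 < ⟪A v, v⟫) :
    ∃ c > 0, ∀ v, c * ‖v‖ ^ 2 ≤ ⟪A v, v⟫ := by
  have hcont : Continuous fun v => ⟪A v, v⟫ := A.continuous.inner continuous_id
  obtain ⟨c, hc, hsphere⟩ := (isCompact_sphere (0 : E) 1).exists_forall_le' hcont.continuousOn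
    (a := 0) fun v hv => hA v (ne_zero_of_mem_unit_sphere ⟨v, hv⟩)
  refine ⟨c, hc, fun v => ?_⟩
  rcases eq_or_ne v 0 with rfl | hv
  · simp
  have hnorm : ‖v‖ ≠ 0 := norm_ne_zero_iff.2 hv
  have hunit := hsphere (‖v‖⁻¹ • v) (by simp [norm_smul, hv])
  simp only [map_smul, real_inner_smul_left, real_inner_smul_right] at hunit
  calc c * ‖v‖ ^ 2 ≤ ‖v‖⁻¹ * (‖v‖⁻¹ * ⟪A v, v⟫) * ‖v‖ ^ 2 := by gcongr
    _ = ⟪A v, v⟫ := by field_simp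

lemma exists_coercive_of_posDef {ι : Type*} [Fintype ι] [DecidableEq ι] {C : Matrix ι ι ℝ}
    (hC : C.PosDef) : ∃ c > 0, ∀ v, c * ‖v‖ ^ 2 ≤ ⟪Matrix.toEuclideanCLM (𝕜 := ℝ) C v, v⟫ := by
  refine exists_coercive_of_pos fun v hv => ?_
  rw [real_inner_comm, Matrix.inner_toEuclideanCLM]
  exact hC.dotProduct_mulVec_pos ((WithLp.ofLp_eq_zero 2).not.2 hv)

end Coercivity

section Gaussian

variable {ι : Type*} [Fintype ι] [DecidableEq ι]

lemma charFun_map_normalizedScore {n : ℕ} (X : Matrix (Fin n) ι ℝ) (σ : ℝ≥0)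
    (t : EuclideanSpace ℝ ι) :
    charFun ((Measure.pi fun _ : Fin n => gaussianReal 0 (σ ^ 2)).map (normalizedScore X)) t =
      Complex.exp (-((σ ^ 2 * ⟪gramOperator X t, t⟫ / 2 : ℝ) : ℂ)) := by
  set s : EuclideanSpace ℝ (Fin n) := WithLp.toLp 2 ((1 / √(n : ℝ)) • (X *ᵥ t.ofLp)) with hs
  have hdual : charFun ((Measure.pi fun _ : Fin n => gaussianReal 0 (σ ^ 2)).map
      (normalizedScore X)) t =
      charFun ((Measure.pi fun _ : Fin n => gaussianReal 0 (σ ^ 2)).map (WithLp.toLp 2)) s := by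
    rw [charFun_apply, charFun_apply,
      integral_map (continuous_normalizedScore X).aemeasurable (by fun_prop),
      integral_map (by fun_prop) (by fun_prop)]
    simp only [inner_normalizedScore_eq_inner_toLp X, hs]
  have hsq : ∀ i, s i ^ 2 = 1 / (n : ℝ) * (X *ᵥ t.ofLp) i ^ 2 := fun i => by
    simp [hs, mul_pow, Real.sq_sqrt]
  rw [hdual, charFun_pi]
  simp only [charFun_gaussianReal]
  rw [← Complex.exp_sum, inner_gramOperator, Finset.mul_sum, Finset.mul_sum, Finset.sum_div,
    Complex.ofReal_sum, ← Finset.sum_neg_distrib]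
  congr 1
  refine Finset.sum_congr rfl fun i _ => ?_
  rw [← hsq]
  push_cast
  ring

lemma charFun_multivariateGaussian_zero_smul {C : Matrix ι ι ℝ} (hC : C.PosSemidef) (σ : ℝ≥0)
    (t : EuclideanSpace ℝ ι) :
    charFun (multivariateGaussian 0 ((σ : ℝ) ^ 2 • C)) t =
      Complex.exp (-((σ ^ 2 * ⟪Matrix.toEuclideanCLM (𝕜 := ℝ) C t, t⟫ / 2 : ℝ) : ℂ)) := by
  rw [charFun_multivariateGaussian (hC.smul (by positivity)),
    real_inner_comm t (Matrix.toEuclideanCLM (𝕜 := ℝ) C t), Matrix.inner_toEuclideanCLM,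
    Matrix.smul_mulVec, dotProduct_smul]
  simp

lemma tendstoInDistribution_normalizedScore {Ω : Type*} [MeasurableSpace Ω] {P : Measure Ω}
    [IsProbabilityMeasure P] {X : (n : ℕ) → Matrix (Fin n) ι ℝ} {C : Matrix ι ι ℝ}
    (hC : C.PosSemidef)
    (hX : Tendsto (fun n : ℕ => (1 / (n : ℝ)) • ((X n)ᵀ * X n)) atTop (𝓝 C))
    {σ : ℝ≥0} {ε : (n : ℕ) → Ω → Fin n → ℝ}
    (hε : ∀ n, HasLaw (ε n) (Measure.pi fun _ : Fin n => gaussianReal 0 (σ ^ 2)) P) :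
    TendstoInDistribution (fun n ω => normalizedScore (X n) (ε n ω)) atTop id (fun _ => P)
      (multivariateGaussian 0 ((σ : ℝ) ^ 2 • C)) where
  forall_aemeasurable n := (continuous_normalizedScore _).measurable.comp_aemeasurable
    (hε n).aemeasurable
  aemeasurable_limit := aemeasurable_id
  tendsto := by
    refine ProbabilityMeasure.tendsto_iff_tendsto_charFun.2 fun t => ?_
    have hlaw : ∀ n, P.map (fun ω => normalizedScore (X n) (ε n ω)) =
        (Measure.pi fun _ => gaussianReal 0 (σ ^ 2)).map (normalizedScore (X n)) := fun n => by
      rw [← (hε n).map_eq, AEMeasurable.map_map_of_aemeasurable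
        (continuous_normalizedScore _).aemeasurable (hε n).aemeasurable]
      rfl
    simp only [ProbabilityMeasure.coe_mk, hlaw, charFun_map_normalizedScore, Measure.map_id,
      charFun_multivariateGaussian_zero_smul hC]
    have hgram : Tendsto (fun n => gramOperator (X n) t) atTop
        (𝓝 (Matrix.toEuclideanCLM (𝕜 := ℝ) C t)) :=
      ((ContinuousLinearMap.apply ℝ _ t).continuous.tendsto _).comp (tendsto_gramOperator hX)
    have hvar := ((hgram.inner (tendsto_const_nhds (x := t))).const_mul ((σ : ℝ) ^ 2)).div_const 2
    exact (Complex.continuous_exp.tendsto _).comp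
      ((Complex.continuous_ofReal.tendsto _).comp hvar).neg

lemma not_ae_norm_le_multivariateGaussian [Nonempty ι] {S : Matrix ι ι ℝ} (hS : S.PosDef)
    (K : ℝ) : ¬ ∀ᵐ x ∂(multivariateGaussian 0 S), ‖x‖ ≤ K := by
  intro hbound
  obtain ⟨i⟩ := ‹Nonempty ι›
  have hmarginal := measurePreserving_eval_multivariateGaussian (μ := 0) hS.posSemidef (i := i)
  have hvar : (S i i).toNNReal ≠ 0 := by simpa using hS.diag_pos (i := i)
  have hgauss : ∀ᵐ x ∂(gaussianReal 0 (S i i).toNNReal), x ∈ Set.Iic K := by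
    have hmap := hmarginal.map_eq
    simp only [PiLp.zero_apply] at hmap
    rw [← hmap]
    refine (ae_map_iff hmarginal.measurable.aemeasurable (measurableSet_Iic (a := K))).2 ?_
    filter_upwards [hbound] with x hx
    exact (Real.le_norm_self _).trans ((PiLp.norm_apply_le x i).trans hx)
  have hnull : volume (Set.Iic K)ᶜ = 0 := (gaussianReal_absolutelyContinuous' 0 hvar).ae_le hgauss
  simp at hnull

end Gaussian

section TransferEstimation

variable {E : Type*} [NormedAddCommGroup E] [InnerProductSpace ℝ E] {N : Seminorm ℝ E}

lemma localIncrement_smul (N : Seminorm ℝ E) (β u : E) {s : ℝ} (hs : 0 ≤ s) :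
    localIncrement N β s (s • u) = s * localIncrement N β 1 u := by
  rw [localIncrement, localIncrement, ← smul_add, map_smul_eq_mul, Real.norm_of_nonneg hs,
    one_smul]
  ring

lemma penalizedQuadratic_transferPenalty_smul (A : E →L[ℝ] E) (N : Seminorm ℝ E) (a b : ℝ)
    (w β d u : E) {s : ℝ} (hs : 0 ≤ s) :
    penalizedQuadratic A (s • w)
        (transferPenalty N (localIncrement N β s) (s * a) (s * b) (s • d)) (s • u) =
      s ^ 2 * penalizedQuadratic A w (transferPenalty N (localIncrement N β 1) a b d) u := by
  simp only [penalizedQuadratic, transferPenalty, map_smul, real_inner_smul_left,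
    real_inner_smul_right, localIncrement_smul N β u hs, ← smul_sub, map_smul_eq_mul,
    Real.norm_of_nonneg hs]
  ring

lemma isMinOn_penalizedQuadratic_smul {A : E →L[ℝ] E} {a b : ℝ} {w β d u : E}
    (hu : IsMinOn (penalizedQuadratic A w (transferPenalty N (localIncrement N β 1) a b d))
      Set.univ u) {s : ℝ} (hs : 0 < s) :
    IsMinOn (penalizedQuadratic A (s • w)
      (transferPenalty N (localIncrement N β s) (s * a) (s * b) (s • d))) Set.univ (s • u) := by
  refine isMinOn_univ_iff.2 fun v => ?_
  rw [← smul_inv_smul₀ hs.ne' v, penalizedQuadratic_transferPenalty_smul A N a b w β d _ hs.le,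
    penalizedQuadratic_transferPenalty_smul A N a b w β d _ hs.le]
  exact mul_le_mul_of_nonneg_left (hu (Set.mem_univ _)) (sq_nonneg s)

lemma norm_le_of_isMinOn_zero_transferPenalty {A : E →L[ℝ] E} {Φ : E → ℝ} {a b M : ℝ} {w d : E}
    (hM₀ : 0 ≤ M) (hM : ∀ u, N u ≤ M * ‖u‖) (hΦ : IsConvexNonexpansive N Φ) (ha : 0 ≤ a)
    (hb : 0 ≤ b)
    (hmin : IsMinOn (penalizedQuadratic A w (transferPenalty N Φ a b d)) Set.univ 0) :
    ‖w‖ ≤ (a + b) * M / 2 := by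
  have hslope : 2 * ⟪w, w⟫ ≤ (a + b) * (M * ‖w‖) := by
    refine two_mul_inner_le_of_isMinOn_zero hmin fun t ht => ?_
    have hle := transferPenalty_sub_le hΦ ha hb d (t • w) 0
    rw [sub_zero, map_smul_eq_mul, Real.norm_of_nonneg ht.le] at hle
    have hN := mul_le_mul_of_nonneg_left (hM w) (mul_nonneg (add_nonneg ha hb) ht.le)
    linear_combination hle + hN
  rcases (norm_nonneg w).eq_or_lt with hw | hw
  · rw [← hw]
    positivity
  · rw [real_inner_self_eq_norm_sq] at hslope
    exact le_of_mul_le_mul_right (by linear_combination hslope / 2) hw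

lemma ne_zero_of_isMinOn_directionalSlope {A : E →L[ℝ] E} {β u : E} {ρ : ℝ}
    (hβ : 0 < N β) (hρ : ρ < 1)
    (hmin : IsMinOn (penalizedQuadratic A 0 (transferPenalty N (directionalSlope N β) 1 ρ 0))
      Set.univ u) : u ≠ 0 := by
  rintro rfl
  have hslope : 2 * ⟪(0 : E), -β⟫ ≤ (ρ - 1) * N β := by
    refine two_mul_inner_le_of_isMinOn_zero hmin fun t ht => ?_
    have hray := directionalSlope_sub_smul N β 0 t
    rw [zero_sub, ← smul_neg] at hray
    simp only [transferPenalty, hray, sub_zero, map_smul_eq_mul, map_neg_eq_map, map_zero,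
      Real.norm_of_nonneg ht.le]
    linarith
  rw [inner_zero_left, mul_zero] at hslope
  nlinarith

lemma eq_zero_of_isMinOn_transferPenalty {A : E →L[ℝ] E} {Φ : E → ℝ} {u : E} {a b c : ℝ}
    (hc : 0 < c) (hA : ∀ v, c * ‖v‖ ^ 2 ≤ ⟪A v, v⟫) (hΦ : IsConvexNonexpansive N Φ) (ha : 0 ≤ a)
    (hab : a ≤ b)
    (hmin : IsMinOn (penalizedQuadratic A 0 (transferPenalty N Φ a b 0)) Set.univ u) : u = 0 := by
  have hzero : ∀ v, transferPenalty N Φ a b 0 0 - 0 * ‖v‖ ≤ transferPenalty N Φ a b 0 v :=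
    fun v => by
      have hle := add_le_transferPenalty (b := b) hΦ ha 0 v
      have hnonneg := mul_nonneg (sub_nonneg.2 hab) (apply_nonneg N (v - 0))
      linear_combination hle + hnonneg
  have hnorm := norm_le_of_penalizedQuadratic_le hc le_rfl hA hzero (hmin (Set.mem_univ 0))
  simpa using hnorm

variable {Ω Ω' : Type*} {A : ℕ → E →L[ℝ] E} {A₀ : E →L[ℝ] E} {β : E} {W δ e : ℕ → Ω → E}
  {a b q r : ℕ → ℝ} {κ : ℝ}

theorem eventually_eq_of_isMinOn_of_tendsto_atTop {k ρ K : ℝ} (hk : 0 < k)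
    (hN : ∀ u, k * ‖u‖ ≤ N u) (hA : Tendsto A atTop (𝓝 A₀)) (hA_nonneg : ∀ n v, 0 ≤ ⟪A n v, v⟫)
    (hr : ∀ᶠ n in atTop, 0 < r n) (hq : ∀ᶠ n in atTop, q n ≠ 0)
    (hrq : Tendsto (fun n => r n / q n) atTop (𝓝 κ)) (ha : ∀ᶠ n in atTop, 0 ≤ a n)
    (hrb : Tendsto (fun n => r n * b n) atTop atTop)
    (hab : Tendsto (fun n => a n / b n) atTop (𝓝 ρ)) (hρ : ρ < 1)
    (hmin : ∀ᶠ n in atTop, ∀ ω, IsMinOn (penalizedQuadratic (A n) ((r n)⁻¹ • W n ω)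
      (transferPenalty N (localIncrement N β 1) (a n) (b n) (δ n ω))) Set.univ (e n ω)) :
    ∀ᶠ n in atTop, ∀ ω, ‖(W n ω, q n • δ n ω)‖ ≤ K → e n ω = δ n ω := by
  have hlhs : Tendsto (fun n => 2 * K + 2 * ‖A n‖ * (|r n / q n| * K)) atTop
      (𝓝 (2 * K + 2 * ‖A₀‖ * (|κ| * K))) :=
    ((hA.norm.const_mul 2).mul (hrq.abs.mul_const K)).const_add (2 * K)
  have hrhs : Tendsto (fun n => r n * b n * ((1 - a n / b n) * k)) atTop atTop :=
    hrb.atTop_mul_pos (mul_pos (sub_pos.2 hρ) hk) ((hab.const_sub 1).mul_const k)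
  filter_upwards [hlhs.eventually_le_const (lt_add_one _),
    hrhs.eventually_gt_atTop (2 * K + 2 * ‖A₀‖ * (|κ| * K) + 1), hr, hq, ha,
    hrb.eventually_gt_atTop 0, hab.eventually_lt_const hρ, hmin]
    with n hle hlt hrn hqn han hbn habn hminn ω hω
  have hb : 0 < b n := pos_of_mul_pos_right hbn hrn.le
  have hW : r n * ‖(r n)⁻¹ • W n ω‖ ≤ K := by
    rw [norm_smul, Real.norm_of_nonneg (inv_nonneg.2 hrn.le), mul_inv_cancel_left₀ hrn.ne']
    exact (norm_fst_le _).trans hω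
  have hδ : r n * ‖δ n ω‖ ≤ |r n / q n| * K := by
    have hscale : r n • δ n ω = (r n / q n) • q n • δ n ω := by
      rw [smul_smul, div_mul_cancel₀ _ hqn]
    calc r n * ‖δ n ω‖ = ‖r n • δ n ω‖ := by rw [norm_smul, Real.norm_of_nonneg hrn.le]
      _ = |r n / q n| * ‖q n • δ n ω‖ := by rw [hscale, norm_smul, Real.norm_eq_abs]
      _ ≤ |r n / q n| * K := by gcongr; exact (norm_snd_le _).trans hω
  refine eq_of_penalizedQuadratic_le_of_sharp (κ := (b n - a n) * k) (hA_nonneg n) (fun v => ?_) ?_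
    (hminn ω (Set.mem_univ _))
  · have hsharp := add_le_transferPenalty (b := b n)
      (isConvexNonexpansive_localIncrement N β 1) han (δ n ω) v
    have hgap : a n ≤ b n := ((div_lt_one hb).1 habn).le
    linear_combination hsharp + mul_le_mul_of_nonneg_left (hN (v - δ n ω)) (sub_nonneg.2 hgap)
  · have hgap : r n * b n * ((1 - a n / b n) * k) = r n * ((b n - a n) * k) := by field_simp
    refine lt_of_mul_lt_mul_left ?_ hrn.le
    linear_combination hlt + hle + 2 * hW + mul_le_mul_of_nonneg_left hδ (norm_nonneg (A n)) * 2 +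
      hgap

variable [MeasurableSpace Ω] {P : Measure Ω} [IsProbabilityMeasure P] [MeasurableSpace Ω']
  {P' : Measure Ω'} [IsProbabilityMeasure P'] [MeasurableSpace E] [BorelSpace E]
  [SecondCountableTopology E] {Z : Ω' → E × E}

theorem tendstoInDistribution_smul_of_tendsto_atTop {k ρ : ℝ} (hk : 0 < k)
    (hN : ∀ u, k * ‖u‖ ≤ N u) (hA : Tendsto A atTop (𝓝 A₀)) (hA_nonneg : ∀ n v, 0 ≤ ⟪A n v, v⟫)
    (hr : ∀ᶠ n in atTop, 0 < r n) (hq : ∀ᶠ n in atTop, q n ≠ 0)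
    (hrq : Tendsto (fun n => r n / q n) atTop (𝓝 κ)) (ha : ∀ᶠ n in atTop, 0 ≤ a n)
    (hrb : Tendsto (fun n => r n * b n) atTop atTop)
    (hab : Tendsto (fun n => a n / b n) atTop (𝓝 ρ)) (hρ : ρ < 1)
    (hV : TendstoInDistribution (fun n ω => (W n ω, q n • δ n ω)) atTop Z (fun _ => P) P')
    (he : ∀ n, AEMeasurable (e n) P)
    (hmin : ∀ᶠ n in atTop, ∀ ω, IsMinOn (penalizedQuadratic (A n) ((r n)⁻¹ • W n ω)
      (transferPenalty N (localIncrement N β 1) (a n) (b n) (δ n ω))) Set.univ (e n ω)) :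
    TendstoInDistribution (fun n ω => q n • e n ω) atTop (fun ω => (Z ω).2) (fun _ => P) P' := by
  refine tendstoInDistribution_of_tendstoInMeasure_sub _ _ (hV.continuous_comp continuous_snd) ?_
    fun n => (he n).const_smul (q n)
  refine tendstoInMeasure_zero_of_forall_tendsto_atTopBoundedBy
    (isBoundedInProbability_of_tendstoInDistribution hV) fun K => ?_
  have heq : ∀ᶠ x : ℕ × Ω in atTopBoundedBy (fun n ω => (W n ω, q n • δ n ω)) K,
      e x.1 x.2 = δ x.1 x.2 :=
    eventually_atTopBoundedBy_iff.2 (eventually_eq_of_isMinOn_of_tendsto_atTop hk hN hA hA_nonneg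
      hr hq hrq ha hrb hab hρ hmin)
  refine tendsto_const_nhds.congr' (heq.mono fun x hx => ?_)
  simp [hx]

variable [ProperSpace E] {c : ℝ}

/-- At scale `s n` the minimiser only sees the directional derivative of `N` at `β`, because
`s n → ∞`. -/
theorem tendstoInDistribution_smul_of_isMinOn {s : ℕ → ℝ} {κ' a₀ b₀ : ℝ} {F : E × E → E}
    (hN : Continuous N) (hc : 0 < c) (hA₀ : ∀ v, c * ‖v‖ ^ 2 ≤ ⟪A₀ v, v⟫)
    (hA : Tendsto A atTop (𝓝 A₀)) (hs : Tendsto s atTop atTop) (hq : ∀ᶠ n in atTop, q n ≠ 0)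
    (hsr : Tendsto (fun n => s n / r n) atTop (𝓝 κ))
    (hsq : Tendsto (fun n => s n / q n) atTop (𝓝 κ'))
    (ha : Tendsto (fun n => s n * a n) atTop (𝓝 a₀))
    (hb : Tendsto (fun n => s n * b n) atTop (𝓝 b₀)) (ha_nonneg : ∀ᶠ n in atTop, 0 ≤ a n)
    (hb_nonneg : ∀ᶠ n in atTop, 0 ≤ b n)
    (hV : TendstoInDistribution (fun n ω => (W n ω, q n • δ n ω)) atTop Z (fun _ => P) P')
    (he : ∀ n, AEMeasurable (e n) P)
    (hmin : ∀ᶠ n in atTop, ∀ ω, IsMinOn (penalizedQuadratic (A n) ((r n)⁻¹ • W n ω)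
      (transferPenalty N (localIncrement N β 1) (a n) (b n) (δ n ω))) Set.univ (e n ω))
    (hF : Continuous F) (hFmin : ∀ x : E × E, IsMinOn (penalizedQuadratic A₀ x.1
      (transferPenalty N (directionalSlope N β) a₀ b₀ x.2)) Set.univ (F x)) :
    TendstoInDistribution (fun n ω => s n • e n ω) atTop (fun ω => F (κ • (Z ω).1, κ' • (Z ω).2))
      (fun _ => P) P' := by
  have hscaled : TendstoInDistribution
      (fun n ω => ((s n / r n) • W n ω, (s n / q n) • q n • δ n ω)) atTop
      (fun ω => (κ • (Z ω).1, κ' • (Z ω).2)) (fun _ => P) P' :=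
    hV.continuous_comp_prodMk_of_tendstoInMeasure_const
      (g := fun x : (E × E) × ℝ × ℝ => (x.2.1 • x.1.1, x.2.2 • x.1.2)) (by fun_prop)
      (tendstoInMeasure_const_of_tendsto (hsr.prodMk_nhds hsq)) fun _ => aemeasurable_const
  have hdini : ∀ R : ℝ, Tendsto (fun x : ℕ × E =>
      directionalSlope N β x.2 - localIncrement N β (s x.1) x.2)
      (atTop ×ˢ 𝓟 (Metric.closedBall 0 R)) (𝓝 0) := fun R => by
    simpa only [Function.comp_def] using!
      (tendsto_directionalSlope_sub_localIncrement hN β R).comp (hs.prodMap tendsto_id)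
  refine tendstoInDistribution_of_isMinOn (Φ := fun n => localIncrement N β (s n))
    (Z := fun ω => (κ • (Z ω).1, κ' • (Z ω).2)) hN hc hA₀ hA
    (isConvexNonexpansive_directionalSlope N β)
    (fun n => isConvexNonexpansive_localIncrement N β (s n)) hdini ha hb ?_ ?_ hscaled
    (fun n => (he n).const_smul (s n)) ?_ hF hFmin
  · filter_upwards [hs.eventually_ge_atTop 0, ha_nonneg] with n hsn han using mul_nonneg hsn han
  · filter_upwards [hs.eventually_ge_atTop 0, hb_nonneg] with n hsn hbn using mul_nonneg hsn hbn
  · filter_upwards [hs.eventually_gt_atTop 0, hq, hmin] with n hsn hqn hminn ω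
    have hscore : (s n / r n) • W n ω = s n • (r n)⁻¹ • W n ω := by
      rw [smul_smul, div_eq_mul_inv]
    have hcentre : (s n / q n) • q n • δ n ω = s n • δ n ω := by
      rw [smul_smul, div_mul_cancel₀ _ hqn]
    rw [hscore, hcentre]
    exact isMinOn_penalizedQuadratic_smul (hminn ω) hsn

theorem hasConvergenceRate_of_isMinOn {a₀ b₀ : ℝ} (hN : Continuous N) (hc : 0 < c)
    (hA₀ : ∀ v, c * ‖v‖ ^ 2 ≤ ⟪A₀ v, v⟫) (hA : Tendsto A atTop (𝓝 A₀))
    (hr : Tendsto r atTop atTop) (hq : ∀ᶠ n in atTop, q n ≠ 0)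
    (hrq : Tendsto (fun n => r n / q n) atTop (𝓝 κ))
    (ha : Tendsto (fun n => r n * a n) atTop (𝓝 a₀))
    (hb : Tendsto (fun n => r n * b n) atTop (𝓝 b₀)) (ha_nonneg : ∀ᶠ n in atTop, 0 ≤ a n)
    (hb_nonneg : ∀ᶠ n in atTop, 0 ≤ b n)
    (hV : TendstoInDistribution (fun n ω => (W n ω, q n • δ n ω)) atTop Z (fun _ => P) P')
    (hZ : ∀ K : ℝ, ¬ ∀ᵐ ω ∂P', ‖(Z ω).1‖ ≤ K) (he : ∀ n, AEMeasurable (e n) P)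
    (hmin : ∀ᶠ n in atTop, ∀ ω, IsMinOn (penalizedQuadratic (A n) ((r n)⁻¹ • W n ω)
      (transferPenalty N (localIncrement N β 1) (a n) (b n) (δ n ω))) Set.univ (e n ω)) :
    HasConvergenceRate P e r := by
  have hr_nonneg := hr.eventually_ge_atTop 0
  have ha₀ : 0 ≤ a₀ := ge_of_tendsto ha ((hr_nonneg.and ha_nonneg).mono fun n hn =>
    mul_nonneg hn.1 hn.2)
  have hb₀ : 0 ≤ b₀ := ge_of_tendsto hb ((hr_nonneg.and hb_nonneg).mono fun n hn =>
    mul_nonneg hn.1 hn.2)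
  have hrr : Tendsto (fun n => r n / r n) atTop (𝓝 1) :=
    tendsto_const_nhds.congr' ((hr.eventually_gt_atTop 0).mono fun n hn => (div_self hn.ne').symm)
  have hslope := isConvexNonexpansive_directionalSlope N β
  obtain ⟨M, hM₀, hM⟩ := N.bound_of_continuous_normedSpace hN
  obtain ⟨F, hF, hFmin⟩ := exists_continuous_isMinOn_transferPenalty hN hc hA₀ hslope ha₀ hb₀
  refine hasConvergenceRate_of_tendstoInDistribution (tendstoInDistribution_smul_of_isMinOn hN hc
    hA₀ hA hr hq hrr hrq ha hb ha_nonneg hb_nonneg hV he hmin hF hFmin) fun hzero => ?_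
  refine hZ ((a₀ + b₀) * M / 2) (hzero.mono fun ω hω => ?_)
  have hminzero := hFmin ((1 : ℝ) • (Z ω).1, κ • (Z ω).2)
  rw [hω, one_smul] at hminzero
  exact norm_le_of_isMinOn_zero_transferPenalty hM₀.le hM hslope ha₀ hb₀ hminzero

theorem exists_isMinOn_tendstoInDistribution_inv_smul {ρ : ℝ} (hN : Continuous N) (hc : 0 < c)
    (hA₀ : ∀ v, c * ‖v‖ ^ 2 ≤ ⟪A₀ v, v⟫) (hA : Tendsto A atTop (𝓝 A₀))
    (hq : ∀ᶠ n in atTop, q n ≠ 0) (hr : ∀ᶠ n in atTop, 0 < r n)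
    (hrq : Tendsto (fun n => r n / q n) atTop (𝓝 κ)) (ha : Tendsto a atTop (𝓝 0))
    (hra : Tendsto (fun n => r n * a n) atTop atTop)
    (hba : Tendsto (fun n => b n / a n) atTop (𝓝 ρ)) (hb_nonneg : ∀ᶠ n in atTop, 0 ≤ b n)
    (hV : TendstoInDistribution (fun n ω => (W n ω, q n • δ n ω)) atTop Z (fun _ => P) P')
    (he : ∀ n, AEMeasurable (e n) P)
    (hmin : ∀ᶠ n in atTop, ∀ ω, IsMinOn (penalizedQuadratic (A n) ((r n)⁻¹ • W n ω)
      (transferPenalty N (localIncrement N β 1) (a n) (b n) (δ n ω))) Set.univ (e n ω)) :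
    ∃ u₀, IsMinOn (penalizedQuadratic A₀ 0 (transferPenalty N (directionalSlope N β) 1 ρ 0))
        Set.univ u₀ ∧
      TendstoInDistribution (fun n ω => (a n)⁻¹ • e n ω) atTop (fun _ => u₀) (fun _ => P) P' := by
  have ha_pos : ∀ᶠ n in atTop, 0 < a n := by
    filter_upwards [hr, hra.eventually_gt_atTop 0] with n hrn hran
      using pos_of_mul_pos_right hran hrn.le
  have hρ : 0 ≤ ρ := ge_of_tendsto hba ((hb_nonneg.and ha_pos).mono fun n hn =>
    div_nonneg hn.1 hn.2.le)
  have hs : Tendsto (fun n => (a n)⁻¹) atTop atTop :=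
    tendsto_inv_nhdsGT_zero.comp (tendsto_nhdsWithin_iff.2 ⟨ha, ha_pos⟩)
  have hsr : Tendsto (fun n => (a n)⁻¹ / r n) atTop (𝓝 0) :=
    hra.inv_tendsto_atTop.congr fun n => by rw [Pi.inv_apply, mul_inv_rev, div_eq_mul_inv]
  have hsq : Tendsto (fun n => (a n)⁻¹ / q n) atTop (𝓝 0) := by
    rw [← zero_mul κ]
    refine (hsr.mul hrq).congr' (hr.mono fun n hn => div_mul_div_cancel₀ hn.ne')
  have hsa : Tendsto (fun n => (a n)⁻¹ * a n) atTop (𝓝 1) :=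
    tendsto_const_nhds.congr' (ha_pos.mono fun n hn => (inv_mul_cancel₀ hn.ne').symm)
  have hsb : Tendsto (fun n => (a n)⁻¹ * b n) atTop (𝓝 ρ) :=
    hba.congr fun n => div_eq_inv_mul _ _
  obtain ⟨F, hF, hFmin⟩ := exists_continuous_isMinOn_transferPenalty hN hc hA₀
    (isConvexNonexpansive_directionalSlope N β) zero_le_one hρ
  refine ⟨F 0, hFmin 0, ?_⟩
  simpa only [zero_smul] using! tendstoInDistribution_smul_of_isMinOn hN hc hA₀ hA hs hq hsr hsq
    hsa hsb (ha_pos.mono fun n hn => hn.le) hb_nonneg hV he hmin hF hFmin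

end TransferEstimation

section TransferLasso

lemma sum_sq_residual_add {n p : ℕ} (X : Matrix (Fin n) (Fin p) ℝ) (e : Fin n → ℝ)
    (β v : EuclideanSpace ℝ (Fin p)) :
    ∑ i, ((X *ᵥ β.ofLp + e) i - (X *ᵥ (β + v).ofLp) i) ^ 2 =
      ∑ i, e i ^ 2 + ∑ i, (X *ᵥ v.ofLp) i ^ 2 - 2 * ∑ i, e i * (X *ᵥ v.ofLp) i := by
  rw [Finset.mul_sum, ← Finset.sum_add_distrib, ← Finset.sum_sub_distrib]
  refine Finset.sum_congr rfl fun i _ => ?_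
  simp only [WithLp.ofLp_add, Matrix.mulVec_add, Pi.add_apply]
  ring

lemma transferLassoObjective_add {n p : ℕ} (X : Matrix (Fin n) (Fin p) ℝ) (e : Fin n → ℝ)
    (lam eta : ℝ) (β₀ β v : EuclideanSpace ℝ (Fin p)) :
    transferLassoObjective X (X *ᵥ β.ofLp + e) lam eta β₀ (β + v) =
      1 / (n : ℝ) * ∑ i, e i ^ 2 + lam / n * l1Seminorm (Fin p) β +
        penalizedQuadratic (gramOperator X) ((√(n : ℝ))⁻¹ • normalizedScore X e)
          (transferPenalty (l1Seminorm (Fin p)) (localIncrement (l1Seminorm (Fin p)) β 1)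
            (lam / n) (eta / n) (β₀ - β)) v := by
  have hscore : ⟪(√(n : ℝ))⁻¹ • normalizedScore X e, v⟫ =
      1 / (n : ℝ) * ∑ i, e i * (X *ᵥ v.ofLp) i := by
    rw [real_inner_smul_left, inner_normalizedScore, ← mul_assoc, one_div, ← mul_inv,
      Real.mul_self_sqrt (Nat.cast_nonneg n), one_div]
  have hcentre : v - (β₀ - β) = β + v - β₀ := by abel
  rw [transferLassoObjective, sum_sq_residual_add, penalizedQuadratic, inner_gramOperator, hscore,
    transferPenalty, localIncrement, hcentre, one_smul]
  simp only [l1Seminorm_apply, PiLp.sub_apply]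
  ring

lemma IsTransferLasso.isMinOn_penalizedQuadratic {n p : ℕ} {X : Matrix (Fin n) (Fin p) ℝ}
    {e : Fin n → ℝ} {lam eta : ℝ} {β₀ β βhat : EuclideanSpace ℝ (Fin p)}
    (h : IsTransferLasso X (X *ᵥ β.ofLp + e) lam eta β₀ βhat) :
    IsMinOn (penalizedQuadratic (gramOperator X) ((√(n : ℝ))⁻¹ • normalizedScore X e)
      (transferPenalty (l1Seminorm (Fin p)) (localIncrement (l1Seminorm (Fin p)) β 1)
        (lam / n) (eta / n) (β₀ - β))) Set.univ (βhat - β) := by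
  refine isMinOn_univ_iff.2 fun v => ?_
  have hle : transferLassoObjective X (X *ᵥ β.ofLp + e) lam eta β₀ (β + (βhat - β)) ≤
      transferLassoObjective X (X *ᵥ β.ofLp + e) lam eta β₀ (β + v) := by
    rw [add_sub_cancel]
    exact h (Set.mem_univ _)
  rw [transferLassoObjective_add, transferLassoObjective_add] at hle
  exact le_of_add_le_add_left hle

lemma sqrt_mul_div_self (x y : ℝ) : √y * (x / y) = x / √y := by
  rw [mul_div_left_comm, Real.sqrt_div_self, div_eq_mul_inv]

lemma tendsto_sqrt_natCast_atTop : Tendsto (fun n : ℕ => √(n : ℝ)) atTop atTop :=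
  Real.tendsto_sqrt_atTop.comp tendsto_natCast_atTop_atTop

lemma tendsto_sqrt_div_sqrt {m : ℕ → ℕ} {r₀ : ℝ}
    (hr₀ : Tendsto (fun n : ℕ => (n : ℝ) / (m n : ℝ)) atTop (𝓝 r₀)) :
    Tendsto (fun n : ℕ => √(n : ℝ) / √(m n : ℝ)) atTop (𝓝 √r₀) := by
  simpa only [Real.sqrt_div (Nat.cast_nonneg _)] using hr₀.sqrt

lemma tendsto_div_natCast_div {x y : ℕ → ℝ} {l : Filter ℝ}
    (h : Tendsto (fun n => x n / y n) atTop l) :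
    Tendsto (fun n : ℕ => x n / (n : ℝ) / (y n / n)) atTop l :=
  h.congr' ((eventually_ne_atTop 0).mono fun _ hn =>
    (div_div_div_cancel_right₀ (Nat.cast_ne_zero.2 hn) _ _).symm)

variable {Ω : Type*} [MeasurableSpace Ω] {P : Measure Ω} [IsProbabilityMeasure P] {p : ℕ}
  {X : (n : ℕ) → Matrix (Fin n) (Fin p) ℝ} {C : Matrix (Fin p) (Fin p) ℝ}
  {ε : (n : ℕ) → Ω → Fin n → ℝ} {βstar : EuclideanSpace ℝ (Fin p)} {m : ℕ → ℕ} {r₀ : ℝ}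
  {βinit βhat : ℕ → Ω → EuclideanSpace ℝ (Fin p)} {lam eta : ℕ → ℝ}
  {Q : Measure (EuclideanSpace ℝ (Fin p) × EuclideanSpace ℝ (Fin p))} [IsProbabilityMeasure Q]

theorem tendstoInDistribution_sqrt_smul_transferLasso_sub {ρ : ℝ}
    (hX : Tendsto (fun n : ℕ => (1 / (n : ℝ)) • ((X n)ᵀ * X n)) atTop (𝓝 C))
    (hm : ∀ᶠ n in atTop, 0 < m n)
    (hr₀ : Tendsto (fun n : ℕ => (n : ℝ) / (m n : ℝ)) atTop (𝓝 r₀))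
    (hQ : TendstoInDistribution (fun n ω => (normalizedScore (X n) (ε n ω),
      √(m n : ℝ) • (βinit n ω - βstar))) atTop id (fun _ => P) Q)
    (hlam : ∀ n, 0 ≤ lam n) (hβhat : ∀ n, AEMeasurable (βhat n) P)
    (hmin : ∀ n ω, IsTransferLasso (X n) (X n *ᵥ βstar.ofLp + ε n ω) (lam n) (eta n)
      (βinit n ω) (βhat n ω))
    (heta : Tendsto (fun n : ℕ => eta n / √(n : ℝ)) atTop atTop)
    (hle : Tendsto (fun n : ℕ => lam n / eta n) atTop (𝓝 ρ)) (hρ : ρ < 1) :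
    TendstoInDistribution (fun n ω => √(m n : ℝ) • (βhat n ω - βstar)) atTop Prod.snd
      (fun _ => P) Q :=
  tendstoInDistribution_smul_of_tendsto_atTop one_pos
    (fun u => (one_mul _).trans_le (norm_le_l1Seminorm u)) (tendsto_gramOperator hX)
    (fun n => inner_gramOperator_nonneg (X n)) (tendsto_sqrt_natCast_atTop.eventually_gt_atTop 0)
    (hm.mono fun n hn => (Real.sqrt_pos.2 (Nat.cast_pos.2 hn)).ne') (tendsto_sqrt_div_sqrt hr₀)
    (Eventually.of_forall fun n => div_nonneg (hlam n) (Nat.cast_nonneg n))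
    (by simpa only [sqrt_mul_div_self] using heta) (tendsto_div_natCast_div hle) hρ hQ
    (fun n => (hβhat n).sub_const βstar)
    (Eventually.of_forall fun n ω => (hmin n ω).isMinOn_penalizedQuadratic)

theorem hasConvergenceRate_sqrt_transferLasso {lam₀ eta₀ : ℝ} (hC : C.PosDef)
    (hX : Tendsto (fun n : ℕ => (1 / (n : ℝ)) • ((X n)ᵀ * X n)) atTop (𝓝 C))
    (hm : ∀ᶠ n in atTop, 0 < m n)
    (hr₀ : Tendsto (fun n : ℕ => (n : ℝ) / (m n : ℝ)) atTop (𝓝 r₀))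
    (hQ : TendstoInDistribution (fun n ω => (normalizedScore (X n) (ε n ω),
      √(m n : ℝ) • (βinit n ω - βstar))) atTop id (fun _ => P) Q)
    (hQ_unbounded : ∀ K : ℝ, ¬ ∀ᵐ x ∂Q, ‖x.1‖ ≤ K) (hlam : ∀ n, 0 ≤ lam n)
    (heta : ∀ n, 0 ≤ eta n) (hβhat : ∀ n, AEMeasurable (βhat n) P)
    (hmin : ∀ n ω, IsTransferLasso (X n) (X n *ᵥ βstar.ofLp + ε n ω) (lam n) (eta n)
      (βinit n ω) (βhat n ω))
    (hlam₀ : Tendsto (fun n : ℕ => lam n / √(n : ℝ)) atTop (𝓝 lam₀))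
    (heta₀ : Tendsto (fun n : ℕ => eta n / √(n : ℝ)) atTop (𝓝 eta₀)) :
    HasConvergenceRate P (fun n ω => βhat n ω - βstar) fun n => √(n : ℝ) := by
  obtain ⟨c, hc, hcoercive⟩ := exists_coercive_of_posDef hC
  exact hasConvergenceRate_of_isMinOn continuous_l1Seminorm hc hcoercive (tendsto_gramOperator hX)
    tendsto_sqrt_natCast_atTop
    (hm.mono fun n hn => (Real.sqrt_pos.2 (Nat.cast_pos.2 hn)).ne') (tendsto_sqrt_div_sqrt hr₀)
    (by simpa only [sqrt_mul_div_self] using hlam₀) (by simpa only [sqrt_mul_div_self] using heta₀)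
    (Eventually.of_forall fun n => div_nonneg (hlam n) (Nat.cast_nonneg n))
    (Eventually.of_forall fun n => div_nonneg (heta n) (Nat.cast_nonneg n)) hQ hQ_unbounded
    (fun n => (hβhat n).sub_const βstar)
    (Eventually.of_forall fun n ω => (hmin n ω).isMinOn_penalizedQuadratic)

theorem exists_isMinOn_tendstoInDistribution_transferLasso {ρ : ℝ} (hC : C.PosDef)
    (hX : Tendsto (fun n : ℕ => (1 / (n : ℝ)) • ((X n)ᵀ * X n)) atTop (𝓝 C))
    (hm : ∀ᶠ n in atTop, 0 < m n)
    (hr₀ : Tendsto (fun n : ℕ => (n : ℝ) / (m n : ℝ)) atTop (𝓝 r₀))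
    (hQ : TendstoInDistribution (fun n ω => (normalizedScore (X n) (ε n ω),
      √(m n : ℝ) • (βinit n ω - βstar))) atTop id (fun _ => P) Q)
    (heta : ∀ n, 0 ≤ eta n) (hβhat : ∀ n, AEMeasurable (βhat n) P)
    (hmin : ∀ n ω, IsTransferLasso (X n) (X n *ᵥ βstar.ofLp + ε n ω) (lam n) (eta n)
      (βinit n ω) (βhat n ω))
    (hlam : Tendsto (fun n : ℕ => lam n / √(n : ℝ)) atTop atTop)
    (hlam_zero : Tendsto (fun n : ℕ => lam n / (n : ℝ)) atTop (𝓝 0))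
    (hle : Tendsto (fun n : ℕ => eta n / lam n) atTop (𝓝 ρ)) :
    ∃ u₀, IsMinOn (penalizedQuadratic (Matrix.toEuclideanCLM (𝕜 := ℝ) C) 0
        (transferPenalty (l1Seminorm (Fin p)) (directionalSlope (l1Seminorm (Fin p)) βstar)
          1 ρ 0)) Set.univ u₀ ∧
      TendstoInDistribution (fun (n : ℕ) ω => ((n : ℝ) / lam n) • (βhat n ω - βstar)) atTop
        (fun _ => u₀) (fun _ => P) Q := by
  obtain ⟨c, hc, hcoercive⟩ := exists_coercive_of_posDef hC
  simp only [← inv_div (lam _)]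
  exact exists_isMinOn_tendstoInDistribution_inv_smul continuous_l1Seminorm hc hcoercive
    (tendsto_gramOperator hX)
    (hm.mono fun n hn => (Real.sqrt_pos.2 (Nat.cast_pos.2 hn)).ne')
    (tendsto_sqrt_natCast_atTop.eventually_gt_atTop 0) (tendsto_sqrt_div_sqrt hr₀) hlam_zero
    (by simpa only [sqrt_mul_div_self] using hlam) (tendsto_div_natCast_div hle)
    (Eventually.of_forall fun n => div_nonneg (heta n) (Nat.cast_nonneg n)) hQ
    (fun n => (hβhat n).sub_const βstar)
    (Eventually.of_forall fun n ω => (hmin n ω).isMinOn_penalizedQuadratic)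

lemma tendsto_sqrt_div_natCast_div {lam : ℕ → ℝ}
    (hlam : Tendsto (fun n : ℕ => lam n / √(n : ℝ)) atTop atTop) :
    Tendsto (fun n : ℕ => √(n : ℝ) / ((n : ℝ) / lam n)) atTop atTop :=
  hlam.congr fun n => by rw [← sqrt_mul_div_self, div_div_eq_mul_div, mul_div_assoc]

lemma isLittleO_natCast_div_sqrt {lam : ℕ → ℝ}
    (hlam : Tendsto (fun n : ℕ => lam n / √(n : ℝ)) atTop atTop) :
    (fun n : ℕ => (n : ℝ) / lam n) =o[atTop] fun n : ℕ => √(n : ℝ) := by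
  refine (Asymptotics.isLittleO_iff_tendsto' ?_).2 ?_
  · filter_upwards [tendsto_sqrt_natCast_atTop.eventually_gt_atTop 0] with n hn hzero
    exact absurd hzero hn.ne'
  · exact (tendsto_sqrt_div_natCast_div hlam).inv_tendsto_atTop.congr fun n => by
      rw [Pi.inv_apply, inv_div]

end TransferLasso

lemma tendstoInDistribution_normalizedScore_prodMk {Ω : Type*} [MeasurableSpace Ω]
    {P : Measure Ω} [IsProbabilityMeasure P] {p : ℕ} {X : (n : ℕ) → Matrix (Fin n) (Fin p) ℝ}
    {C : Matrix (Fin p) (Fin p) ℝ} (hC : C.PosSemidef)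
    (hX : Tendsto (fun n : ℕ => (1 / (n : ℝ)) • ((X n)ᵀ * X n)) atTop (𝓝 C)) {σ : ℝ≥0}
    {ε : (n : ℕ) → Ω → Fin n → ℝ}
    (hε : ∀ n, HasLaw (ε n) (Measure.pi fun _ : Fin n => gaussianReal 0 (σ ^ 2)) P)
    {βstar : EuclideanSpace ℝ (Fin p)} {q : ℕ → ℝ} {βinit : ℕ → Ω → EuclideanSpace ℝ (Fin p)}
    {ν : Measure (EuclideanSpace ℝ (Fin p))} [IsProbabilityMeasure ν]
    (hz : TendstoInDistribution (fun n ω => q n • (βinit n ω - βstar)) atTop id (fun _ => P) ν)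
    (hindep : ∀ n, IndepFun (βinit n) (ε n) P) :
    TendstoInDistribution (fun n ω => (normalizedScore (X n) (ε n ω),
      q n • (βinit n ω - βstar))) atTop id (fun _ => P)
      ((multivariateGaussian 0 ((σ : ℝ) ^ 2 • C)).prod ν) :=
  tendstoInDistribution_prodMk_of_indepFun (tendstoInDistribution_normalizedScore hC hX hε) hz
    fun n => (hindep n).symm.comp (continuous_normalizedScore (X n)).measurable
      ((measurable_id.sub_const βstar).const_smul (q n))

lemma not_ae_norm_fst_le_multivariateGaussian_prod {ι F : Type*} [Fintype ι] [DecidableEq ι]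
    [Nonempty ι] [MeasurableSpace F] {S : Matrix ι ι ℝ} (hS : S.PosDef) (ν : Measure F)
    [IsProbabilityMeasure ν] (K : ℝ) :
    ¬ ∀ᵐ x ∂((multivariateGaussian 0 S).prod ν), ‖x.1‖ ≤ K := fun h =>
  not_ae_norm_le_multivariateGaussian hS K
    ((Measure.ae_ae_of_ae_prod h).mono fun _ hx => eventually_const.1 hx)

theorem mainTheorem6_general {Ω : Type*} [MeasurableSpace Ω] {P : Measure Ω}
    [IsProbabilityMeasure P] {p : ℕ} {X : (n : ℕ) → Matrix (Fin n) (Fin p) ℝ}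
    {C : Matrix (Fin p) (Fin p) ℝ} (hC : C.PosDef)
    (hX : Tendsto (fun n : ℕ => (1 / (n : ℝ)) • ((X n)ᵀ * X n)) atTop (𝓝 C))
    {ε : (n : ℕ) → Ω → Fin n → ℝ} {βstar : EuclideanSpace ℝ (Fin p)} {m : ℕ → ℕ}
    (hm : ∀ᶠ n in atTop, 0 < m n) {r₀ : ℝ}
    (hr₀ : Tendsto (fun n : ℕ => (n : ℝ) / (m n : ℝ)) atTop (𝓝 r₀))
    {βinit : ℕ → Ω → EuclideanSpace ℝ (Fin p)}
    {Q : Measure (EuclideanSpace ℝ (Fin p) × EuclideanSpace ℝ (Fin p))} [IsProbabilityMeasure Q]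
    (hQ : TendstoInDistribution (fun n ω => (normalizedScore (X n) (ε n ω),
      √(m n : ℝ) • (βinit n ω - βstar))) atTop id (fun _ => P) Q)
    (hQ_unbounded : ∀ K : ℝ, ¬ ∀ᵐ x ∂Q, ‖x.1‖ ≤ K) {lam eta : ℕ → ℝ} (hlam : ∀ n, 0 ≤ lam n)
    (heta : ∀ n, 0 ≤ eta n) {βhat : ℕ → Ω → EuclideanSpace ℝ (Fin p)}
    (hβhat : ∀ n, AEMeasurable (βhat n) P)
    (hmin : ∀ n ω, IsTransferLasso (X n) (X n *ᵥ βstar.ofLp + ε n ω) (lam n) (eta n)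
      (βinit n ω) (βhat n ω)) :
    (∀ ρ < 1, Tendsto (fun n : ℕ => eta n / √(n : ℝ)) atTop atTop →
      Tendsto (fun n : ℕ => lam n / eta n) atTop (𝓝 ρ) →
      ConvergesAtRate P (fun n ω => βhat n ω - βstar) (fun n => √(m n : ℝ)) ∧
      (Q.snd ≠ Measure.dirac 0 →
        HasConvergenceRate P (fun n ω => βhat n ω - βstar) (fun n => √(m n : ℝ)))) ∧
    (∀ lam₀ eta₀ : ℝ, Tendsto (fun n : ℕ => lam n / √(n : ℝ)) atTop (𝓝 lam₀) →
      Tendsto (fun n : ℕ => eta n / √(n : ℝ)) atTop (𝓝 eta₀) →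
      HasConvergenceRate P (fun n ω => βhat n ω - βstar) (fun n => √(n : ℝ))) ∧
    (∀ ρ : ℝ, Tendsto (fun n : ℕ => lam n / √(n : ℝ)) atTop atTop →
      Tendsto (fun n : ℕ => lam n / (n : ℝ)) atTop (𝓝 0) →
      Tendsto (fun n : ℕ => eta n / lam n) atTop (𝓝 ρ) →
      (ρ < 1 →
        ConvergesAtRate P (fun n ω => βhat n ω - βstar) (fun n => (n : ℝ) / lam n) ∧
        (fun n : ℕ => (n : ℝ) / lam n) =o[atTop] (fun n : ℕ => √(n : ℝ)) ∧
        (βstar ≠ 0 →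
          HasConvergenceRate P (fun n ω => βhat n ω - βstar) (fun n => (n : ℝ) / lam n) ∧
          ¬ IsBoundedInProbability P (fun n ω => √(n : ℝ) • (βhat n ω - βstar)))) ∧
      (1 ≤ ρ →
        HasRateFasterThan P (fun n ω => βhat n ω - βstar) (fun n => (n : ℝ) / lam n))) := by
  refine ⟨fun ρ hρ hetaInf hle => ?_, fun lam₀ eta₀ => hasConvergenceRate_sqrt_transferLasso hC hX
    hm hr₀ hQ hQ_unbounded hlam heta hβhat hmin, fun ρ hlamInf hlamZero hle => ?_⟩
  · have hlim := tendstoInDistribution_sqrt_smul_transferLasso_sub hX hm hr₀ hQ hlam hβhat hmin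
      hetaInf hle hρ
    have : IsProbabilityMeasure (Q.map Prod.snd) :=
      Measure.isProbabilityMeasure_map hlim.aemeasurable_limit
    exact ⟨convergesAtRate_of_tendstoInDistribution hlim,
      fun hν => ⟨⟨Q.snd, this⟩, tendstoInDistribution_id_map hlim, hν⟩⟩
  obtain ⟨u₀, hu₀, hlim⟩ := exists_isMinOn_tendstoInDistribution_transferLasso hC hX hm hr₀ hQ heta
    hβhat hmin hlamInf hlamZero hle
  have hprob := tendstoInMeasure_of_tendstoInDistribution_const hlim
  refine ⟨fun hρ => ⟨convergesAtRate_of_tendstoInDistribution hlim,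
    isLittleO_natCast_div_sqrt hlamInf, fun hβ => ?_⟩, fun hρ => ?_⟩
  · have hβ_pos : 0 < l1Seminorm (Fin p) βstar :=
      (norm_pos_iff.2 hβ).trans_le (norm_le_l1Seminorm βstar)
    have hu₀_ne : u₀ ≠ 0 := ne_zero_of_isMinOn_directionalSlope hβ_pos hρ hu₀
    exact ⟨hasConvergenceRate_of_tendstoInDistribution hlim (by simpa using hu₀_ne),
      not_isBoundedInProbability_smul hu₀_ne hprob (tendsto_sqrt_div_natCast_div hlamInf)⟩
  · obtain ⟨c, hc, hcoercive⟩ := exists_coercive_of_posDef hC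
    rwa [eq_zero_of_isMinOn_transferPenalty hc hcoercive
      (isConvexNonexpansive_directionalSlope _ βstar) zero_le_one hρ hu₀] at hprob

end

theorem mainTheorem6
    {Ω : Type*} [MeasurableSpace Ω] (P : Measure Ω) [IsProbabilityMeasure P]
    (p : ℕ) (hp : 0 < p)
    -- target data: design, Gaussian noise, true parameter
    (X : (n : ℕ) → Matrix (Fin n) (Fin p) ℝ) (hX : DesignCondition X)
    (σ : ℝ≥0) (hσ : 0 < σ)
    (ε : (n : ℕ) → Ω → Fin n → ℝ)
    (hε : ∀ n, HasLaw (ε n) (Measure.pi fun _ : Fin n => gaussianReal 0 (σ ^ 2)) P)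
    (βstar : EuclideanSpace ℝ (Fin p))
    -- source data: sample size `m n`, initial estimator, limit law `ν` of its scaled error
    (m : ℕ → ℕ) (hm : ∀ᶠ n in atTop, 0 < m n)
    (r₀ : ℝ) (hr₀ : Tendsto (fun n : ℕ => (n : ℝ) / (m n : ℝ)) atTop (𝓝 r₀))
    (βinit : ℕ → Ω → EuclideanSpace ℝ (Fin p))
    (hβinit : ∀ n, AEMeasurable (βinit n) P)
    (ν : Measure (EuclideanSpace ℝ (Fin p))) [IsProbabilityMeasure ν]
    (hz : TendstoInDistribution (fun n ω => √(m n : ℝ) • (βinit n ω - βstar)) atTop id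
      (fun _ => P) ν)
    (hindep : ∀ n, IndepFun (βinit n) (ε n) P)
    -- regularisation parameters and the Transfer Lasso estimator
    (lam eta : ℕ → ℝ) (hlam : ∀ n, 0 ≤ lam n) (heta : ∀ n, 0 ≤ eta n)
    (βhat : ℕ → Ω → EuclideanSpace ℝ (Fin p))
    (hβhat : ∀ n, AEMeasurable (βhat n) P)
    (hmin : ∀ n ω, IsTransferLasso (X n) (X n *ᵥ βstar.ofLp + ε n ω) (lam n) (eta n)
      (βinit n ω) (βhat n ω)) :
    -- (i)
    (∀ ρ₀ : ℝ, 0 ≤ ρ₀ → ρ₀ < 1 →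
      Tendsto (fun n : ℕ => eta n / √(n : ℝ)) atTop atTop →
      Tendsto (fun n : ℕ => lam n / eta n) atTop (𝓝 ρ₀) →
      ConvergesAtRate P (fun n ω => βhat n ω - βstar) (fun n => √(m n : ℝ)) ∧
      (ν ≠ Measure.dirac 0 →
        HasConvergenceRate P (fun n ω => βhat n ω - βstar) (fun n => √(m n : ℝ)))) ∧
    -- (ii)
    (∀ lam₀ eta₀ : ℝ, 0 ≤ lam₀ → 0 ≤ eta₀ →
      Tendsto (fun n : ℕ => lam n / √(n : ℝ)) atTop (𝓝 lam₀) →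
      Tendsto (fun n : ℕ => eta n / √(n : ℝ)) atTop (𝓝 eta₀) →
      HasConvergenceRate P (fun n ω => βhat n ω - βstar) (fun n => √(n : ℝ))) ∧
    -- (iii)
    (∀ ρ₀' : ℝ, 0 ≤ ρ₀' →
      Tendsto (fun n : ℕ => lam n / √(n : ℝ)) atTop atTop →
      Tendsto (fun n : ℕ => lam n / (n : ℝ)) atTop (𝓝 0) →
      Tendsto (fun n : ℕ => eta n / lam n) atTop (𝓝 ρ₀') →
      (ρ₀' < 1 →
        ConvergesAtRate P (fun n ω => βhat n ω - βstar) (fun n => (n : ℝ) / lam n) ∧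
        (fun n : ℕ => (n : ℝ) / lam n) =o[atTop] (fun n : ℕ => √(n : ℝ)) ∧
        (βstar ≠ 0 →
          HasConvergenceRate P (fun n ω => βhat n ω - βstar) (fun n => (n : ℝ) / lam n) ∧
          ¬ IsBoundedInProbability P (fun n ω => √(n : ℝ) • (βhat n ω - βstar)))) ∧
      (1 ≤ ρ₀' →
        HasRateFasterThan P (fun n ω => βhat n ω - βstar) (fun n => (n : ℝ) / lam n))) := by
  obtain ⟨⟨C, hC, hgram⟩, -⟩ := hX
  have : Nonempty (Fin p) := Fin.pos_iff_nonempty.1 hp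
  have hQ := tendstoInDistribution_normalizedScore_prodMk hC.posSemidef hgram hε hz hindep
  have hS : ((σ : ℝ) ^ 2 • C).PosDef := hC.smul (by positivity)
  obtain ⟨hi, hii, hiii⟩ := mainTheorem6_general hC hgram hm hr₀ hQ
    (not_ae_norm_fst_le_multivariateGaussian_prod hS ν) hlam heta hβhat hmin
  rw [Measure.snd_prod] at hi
  exact ⟨fun ρ₀ _ => hi ρ₀, fun lam₀ eta₀ _ _ => hii lam₀ eta₀, fun ρ₀' _ => hiii ρ₀'⟩
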